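/- Let $(\mathcal X,d_{\mathcal X})$, $(\mathcal Y,d_{\mathcal Y})$ be bounded Polish metric spaces, $\mu\in\mathcal P(\mathcal X)$, $\nu\in\mathcal P(\mathcal Y)$, and let $\Pi(\mu,\nu)$ be the set of probability measures on $\mathcal X\times\mathcal Y$ with marginals $\mu$ and $\nu$. Let $R\in\mathcal P(\mathcal X\times\mathcal Y)$ with $R\ll\mu\otimes\nu$, and let $H(\cdot\,\|\,R)$ be the relative entropy. Let $F:\mathcal P(\mathcal X\times\mathcal Y)\to\mathbb R$ satisfy: (i) $F$ is convex and $F\ge 0$; (ii) $F$ has a jointly continuous (weak topology on $\mathcal P(\mathcal X\times\mathcal Y)$) linear derivative $\frac{\delta F}{\delta m}:\mathcal P(\mathcal X\times\mathcal Y)\times(\mathcal X\times\mathcal Y)\to\mathbb R$, that is, for all $\pi,\pi'$, $$F(\pi)-F(\pi')=\int_0^1\!\int \tfrac{\delta F}{\delta m}\bigl((1-\eta)\pi'+\eta\pi,x,y\bigr)\,d(\pi-\pi')(x,y)\,d\eta,$$ and $\sup_\pi\operatorname{osc}\bigl(\frac{\delta F}{\delta m}(\pi,\cdot)\bigr)<\infty$;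 (iii) there is $L>0$ with $\bigl\|\frac{\delta F}{\delta m}(P,\cdot)-\frac{\delta F}{\delta m}(Q,\cdot)\bigr\|_{L^\infty(\mu\otimes\nu)}\le L\,W_1(P,Q)$ for all $P,Q\in\Pi(\mu,\nu)$. Assume that there are $P_0\in\Pi(\mu,\nu)$ and constants $0<b_-\le b_+<\infty$ with $P_0\ll R$ and $b_-\le dP_0/dR\le b_+$ $R$-a.e. For $P\in\Pi(\mu,\nu)$, let $T(P)$ denote the unique minimizer over $\pi\in\Pi(\mu,\nu)$ of $\int\frac{\delta F}{\delta m}(P,x,y)\,\pi(dx,dy)+H(\pi\,\|\,R)$. Then $V(\pi):=F(\pi)+H(\pi\,\|\,R)$ has a unique minimizer $\pi^\star$ over $\Pi(\mu,\nu)$, and $T(\pi^\star)=\pi^\star$. Moreover $\pi^\star\ll R$, $d\pi^\star/dR>0$ $R$-a.e., and there are measurable $f^\star:\mathcal X\to\mathbb R$, $g^\star:\mathcal Y\to\mathbb R$ and a constant $c^\star\in\mathbb R$ such that $$\tfrac{\delta F}{\delta m}(\pi^\star,x,y)+\log\tfrac{d\pi^\star}{dR}(x,y)+f^\star(x)+g^\star(y)=c^\star\qquad\text{for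 $R$-a.e. }(x,y);$$ with the same potentials, $d\pi^\star\propto e^{-f^\star(x)-g^\star(y)}\,dR_{\pi^\star}$, where $R_{\pi^\star}$ is the tilted probability measure $dR_{\pi^\star}\propto e^{-\frac{\delta F}{\delta m}(\pi^\star,\cdot)}\,dR$. The fixed-point property and the first-order system are equivalent: for every $\pi\in\Pi(\mu,\nu)$, $T(\pi)=\pi$ (i.e. $\pi$ is the unique minimizer of the problem defining $T(\pi)$) if and only if $\pi\ll R$, $d\pi/dR>0$ $R$-a.e. and there are measurable real-valued $f,g$ and a constant $c\in\mathbb R$ with $\frac{\delta F}{\delta m}(\pi,x,y)+\log\frac{d\pi}{dR}(x,y)+f(x)+g(y)=c$ for $R$-a.e. $(x,y)$. -/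

import Mathlib

open MeasureTheory InformationTheory Set
open scoped ENNReal unitInterval

noncomputable section

namespace EntropicOT

/-- The convex combination `(1 - t) P + t Q` of two probability measures, `t ∈ [0, 1]`. -/
def mix {Z : Type*} [MeasurableSpace Z] (t : I) (P Q : ProbabilityMeasure Z) :
    ProbabilityMeasure Z :=
  ⟨ENNReal.ofReal (1 - (t : ℝ)) • (P : Measure Z) + ENNReal.ofReal (t : ℝ) • (Q : Measure Z), by
    constructor
    simp only [Measure.coe_add, Measure.coe_smul, Pi.add_apply, Pi.smul_apply, measure_univ,
      smul_eq_mul, mul_one]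
    rw [← ENNReal.ofReal_add (sub_nonneg.2 t.2.2) t.2.1]
    simp⟩

/-- `Π(μ, ν)`: the probability measures on `X × Y` with marginals `μ` and `ν`. -/
def couplings {X Y : Type*} [MeasurableSpace X] [MeasurableSpace Y]
    (μ : ProbabilityMeasure X) (ν : ProbabilityMeasure Y) : Set (ProbabilityMeasure (X × Y)) :=
  {π | (π : Measure (X × Y)).map Prod.fst = (μ : Measure X) ∧
    (π : Measure (X × Y)).map Prod.snd = (ν : Measure Y)}

/-- The 1-Wasserstein distance (finite on bounded spaces). -/
def wasserstein1 {Z : Type*} [PseudoEMetricSpace Z] [MeasurableSpace Z]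
    (ρ η : ProbabilityMeasure Z) : ℝ≥0∞ :=
  ⨅ γ ∈ couplings ρ η, ∫⁻ z, edist z.1 z.2 ∂(γ : Measure (Z × Z))

/-- The set of minimizers of `Φ` over `S`. -/
def argminOn {E : Type*} (Φ : E → EReal) (S : Set E) : Set E :=
  {π | π ∈ S ∧ ∀ ρ ∈ S, Φ π ≤ Φ ρ}

/-- `dF` is a (continuous) linear functional derivative of `F`: it is jointly continuous, for the
weak topology on probability measures, and
`F π - F π' = ∫₀¹ ∫ dF ((1 - η) π' + η π) d(π - π') dη`. -/
structure HasLinearDerivative {Z : Type*} [TopologicalSpace Z] [MeasurableSpace Z]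
    [OpensMeasurableSpace Z] (F : ProbabilityMeasure Z → ℝ) (dF : ProbabilityMeasure Z → Z → ℝ) :
    Prop where
  continuous : Continuous (fun p : ProbabilityMeasure Z × Z => dF p.1 p.2)
  sub_eq : ∀ π π' : ProbabilityMeasure Z,
    F π - F π' = ∫ η : I, ((∫ z, dF (mix η π' π) z ∂(π : Measure Z)) -
      ∫ z, dF (mix η π' π) z ∂(π' : Measure Z))

/-- The assumptions on the cost functional `F` and its linear derivative `dF`: `F` is convex and
nonnegative, `dF` is a linear derivative of `F` whose oscillation is bounded uniformly, and `dF` is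
Lipschitz from `(Π(μ, ν), W₁)` to `L^∞(μ ⊗ ν)`. -/
structure CostAssumption {X Y : Type*} [MetricSpace X] [SecondCountableTopology X]
    [MeasurableSpace X] [BorelSpace X] [MetricSpace Y] [SecondCountableTopology Y]
    [MeasurableSpace Y] [BorelSpace Y] (μ : ProbabilityMeasure X) (ν : ProbabilityMeasure Y)
    (F : ProbabilityMeasure (X × Y) → ℝ) (dF : ProbabilityMeasure (X × Y) → X × Y → ℝ) :
    Prop where
  convex : ∀ (t : I) (π π' : ProbabilityMeasure (X × Y)),
    F (mix t π π') ≤ (1 - (t : ℝ)) * F π + (t : ℝ) * F π'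
  nonneg : ∀ π, 0 ≤ F π
  hasLinearDerivative : HasLinearDerivative F dF
  bounded_osc : ∃ C : ℝ, 0 < C ∧ ∀ π z z', dF π z - dF π z' ≤ C
  lipschitz : ∃ L : ℝ, 0 < L ∧ ∀ P ∈ couplings μ ν, ∀ Q ∈ couplings μ ν,
    eLpNorm (fun z => dF P z - dF Q z) ∞ ((μ : Measure X).prod (ν : Measure Y)) ≤
      ENNReal.ofReal L * wasserstein1 P Q

/-- The total energy `V π = F π + H(π ‖ R)`, with values in `(-∞, +∞]`. -/
def energy {Z : Type*} [MeasurableSpace Z] (R : ProbabilityMeasure Z)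
    (F : ProbabilityMeasure Z → ℝ) (π : ProbabilityMeasure Z) : EReal :=
  (F π : EReal) + (klDiv (π : Measure Z) (R : Measure Z) : EReal)

/-- The inner objective at `P`: `π ↦ ∫ dF P dπ + H(π ‖ R)`, with values in `(-∞, +∞]`. -/
def innerObjective {Z : Type*} [MeasurableSpace Z] (R : ProbabilityMeasure Z)
    (dF : ProbabilityMeasure Z → Z → ℝ) (P π : ProbabilityMeasure Z) : EReal :=
  ((∫ z, dF P z ∂(π : Measure Z) : ℝ) : EReal) +
    (klDiv (π : Measure Z) (R : Measure Z) : EReal)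

/-- The minimizers of the inner objective at `P` over `Π(μ, ν)`. The best response satisfies
`T P = Q` exactly when this set is the singleton `{Q}`. -/
def bestResponse {X Y : Type*} [MeasurableSpace X] [MeasurableSpace Y]
    (μ : ProbabilityMeasure X) (ν : ProbabilityMeasure Y) (R : ProbabilityMeasure (X × Y))
    (dF : ProbabilityMeasure (X × Y) → X × Y → ℝ) (P : ProbabilityMeasure (X × Y)) :
    Set (ProbabilityMeasure (X × Y)) :=
  argminOn (innerObjective R dF P) (couplings μ ν)

/-- `P` has a density with respect to `R` that is bounded and bounded away from zero. -/
def HasBoundedDensity {Z : Type*} [MeasurableSpace Z] (P R : ProbabilityMeasure Z) : Prop :=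
  (P : Measure Z) ≪ (R : Measure Z) ∧ ∃ b₁ b₂ : ℝ, 0 < b₁ ∧ b₁ ≤ b₂ ∧
    ∀ᵐ z ∂(R : Measure Z), ENNReal.ofReal b₁ ≤ (P : Measure Z).rnDeriv (R : Measure Z) z ∧
      (P : Measure Z).rnDeriv (R : Measure Z) z ≤ ENNReal.ofReal b₂

/-- The first-order system with potentials `f, g` and constant `c`: `π ≪ R`, and `R`-a.e. the
density of `π` is positive (so that its logarithm is a true one) and
`dF π (x, y) + log (dπ/dR (x, y)) + f x + g y = c`. -/
def FirstOrder {X Y : Type*} [MeasurableSpace X] [MeasurableSpace Y]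
    (R : ProbabilityMeasure (X × Y)) (dF : ProbabilityMeasure (X × Y) → X × Y → ℝ)
    (π : ProbabilityMeasure (X × Y)) (f : X → ℝ) (g : Y → ℝ) (c : ℝ) : Prop :=
  (π : Measure (X × Y)) ≪ (R : Measure (X × Y)) ∧
    ∀ᵐ z ∂(R : Measure (X × Y)),
      0 < (π : Measure (X × Y)).rnDeriv (R : Measure (X × Y)) z ∧
      dF π z + Real.log ((π : Measure (X × Y)).rnDeriv (R : Measure (X × Y)) z).toReal
        + f z.1 + g z.2 = c

/-- The reference measure tilted at `π`: the probability measure proportional to `e^{-dF π} R`. -/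
def tiltedReference {Z : Type*} [MeasurableSpace Z] (R : ProbabilityMeasure Z)
    (dF : ProbabilityMeasure Z → Z → ℝ) (π : ProbabilityMeasure Z) : Measure Z :=
  (R : Measure Z).tilted (fun z => -dF π z)

end EntropicOT

end

/-! Everything is done on densities with respect to `R`, where entropy is the integral of `klFun`.

Existence. The midpoint convexity of `klFun` is quantitative (`abs_sub_le_midpoint_klFun`), so a
minimizing sequence for the energy is Cauchy in `L¹(R)`. Its limit keeps the marginals. `F` is
Lipschitz in total variation because its derivative has bounded oscillation, and entropy is lower
semicontinuous by Fatou, so the limit is a minimizer (`exists_mem_argminOn_energy`). Differentiating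
the energy along segments shows that a minimizer `π` also minimizes the linearized problem at `π`.

Necessity. If `π` minimizes its own linearized problem, its density `p` is positive, since `klFun`
has slope `-∞` at zero while some coupling of finite entropy has positive density. Perturbing `p` to
`p (1 + ε k)`, with `k` bounded and `k π` of null marginals, shows that `dF π + log p` is orthogonal
to every such `k`. By Hahn–Banach and the duality of `L¹` and `L^∞` it lies in the `L¹(π)`-closure
of the sums `f x + g y`, hence is an a.e. limit of such sums. As `π ≪ μ ⊗ ν`, an a.e. limit of sums
is again a sum (`exists_add_of_ae_tendsto`).

Sufficiency. If the first-order system holds at `π`, then for a coupling `Q` of finite entropy the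
difference of the linearized objectives at `Q` and `π` is exactly `H(Q ‖ π)`, because `f ⊕ g` has
the same integral under `Q` and `π`. This is nonnegative and vanishes only for `Q = π`. The
potentials need not be separately integrable, so equality of the integrals comes from truncation
(`integral_add_eq_of_integrable_parts`).

Uniqueness for the energy follows: by convexity `F` lies above its linearization at `π`, so any
other minimizer of the energy would also minimize the linearized problem, whose only solution is
`π`. -/

namespace EntropicOT

open Filter Topology

/-! ### Densities, mixtures and couplings -/

section Density

variable {Z : Type*} [MeasurableSpace Z]

/-- `q` is a real-valued, measurable, nonnegative density of `P` with respect to `R`. -/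
structure HasDensity (P R : Measure Z) (q : Z → ℝ) : Prop where
  measurable : Measurable q
  nonneg : ∀ z, 0 ≤ q z
  eq : P = R.withDensity (fun z => ENNReal.ofReal (q z))

theorem hasDensity_rnDeriv {P R : Measure Z} [IsFiniteMeasure P] [IsFiniteMeasure R]
    (h : P ≪ R) : HasDensity P R (fun z => (P.rnDeriv R z).toReal) where
  measurable := (Measure.measurable_rnDeriv P R).ennreal_toReal
  nonneg _ := ENNReal.toReal_nonneg
  eq := by
    conv_lhs => rw [← Measure.withDensity_rnDeriv_eq P R h]
    refine withDensity_congr_ae ?_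
    filter_upwards [Measure.rnDeriv_lt_top P R] with z hz
    rw [ENNReal.ofReal_toReal hz.ne]

namespace HasDensity

variable {P R : Measure Z} {q : Z → ℝ}

theorem absolutelyContinuous (h : HasDensity P R q) : P ≪ R := by
  rw [h.eq]; exact withDensity_absolutelyContinuous _ _

theorem rnDeriv_ae_eq [IsFiniteMeasure R] (h : HasDensity P R q) :
    P.rnDeriv R =ᵐ[R] fun z => ENNReal.ofReal (q z) := by
  conv_lhs => rw [h.eq]
  exact Measure.rnDeriv_withDensity R h.measurable.ennreal_ofReal

theorem integrable_iff (h : HasDensity P R q) {g : Z → ℝ} :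
    Integrable g P ↔ Integrable (fun z => q z * g z) R := by
  rw [h.eq, integrable_withDensity_iff_integrable_smul' h.measurable.ennreal_ofReal
    (ae_of_all _ fun _ => ENNReal.ofReal_lt_top)]
  simp only [ENNReal.toReal_ofReal (h.nonneg _), smul_eq_mul]

theorem integral_eq (h : HasDensity P R q) (g : Z → ℝ) :
    ∫ z, g z ∂P = ∫ z, q z * g z ∂ R := by
  rw [h.eq, integral_withDensity_eq_integral_toReal_smul h.measurable.ennreal_ofReal
    (ae_of_all _ fun _ => ENNReal.ofReal_lt_top)]
  simp only [ENNReal.toReal_ofReal (h.nonneg _), smul_eq_mul]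

theorem integrable [IsFiniteMeasure P] (h : HasDensity P R q) : Integrable q R := by
  simpa using h.integrable_iff.1 (integrable_const (1 : ℝ))

theorem integral_eq_one [IsProbabilityMeasure P] (h : HasDensity P R q) :
    ∫ z, q z ∂ R = 1 := by
  simpa using (h.integral_eq (fun _ => 1)).symm

theorem measureReal_eq (h : HasDensity P R q) {A : Set Z} (hA : MeasurableSet A) :
    P.real A = ∫ z in A, q z ∂ R := by
  have := h.integral_eq (A.indicator fun _ => 1)
  rw [integral_indicator hA] at this
  simp only [integral_const, MeasurableSet.univ, measureReal_restrict_apply, univ_inter,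
    smul_eq_mul, mul_one] at this
  rw [this, ← integral_indicator hA]
  congr 1 with z
  by_cases hz : z ∈ A <;> simp [hz]

theorem eq_of_ae_eq {P' : Measure Z} {q' : Z → ℝ} (h : HasDensity P R q)
    (h' : HasDensity P' R q') (hq : q =ᵐ[R] q') : P = P' := by
  rw [h.eq, h'.eq]
  refine withDensity_congr_ae ?_
  filter_upwards [hq] with z hz
  rw [hz]

theorem absolutelyContinuous_of_pos (h : HasDensity P R q) (hq : ∀ᵐ z ∂ R, 0 < q z) : R ≪ P := by
  rw [h.eq]
  refine withDensity_absolutelyContinuous' h.measurable.ennreal_ofReal.aemeasurable ?_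
  filter_upwards [hq] with z hz
  simpa using hz

theorem klDiv_eq [IsFiniteMeasure P] [IsFiniteMeasure R] (h : HasDensity P R q) :
    klDiv P R = ∫⁻ z, ENNReal.ofReal (klFun (q z)) ∂ R := by
  rw [klDiv_eq_lintegral_klFun_of_ac h.absolutelyContinuous]
  refine lintegral_congr_ae ?_
  filter_upwards [h.rnDeriv_ae_eq] with z hz
  rw [hz, ENNReal.toReal_ofReal (h.nonneg z)]

theorem measurable_klFun_comp (h : HasDensity P R q) : Measurable fun z => klFun (q z) :=
  measurable_klFun.comp h.measurable

theorem klDiv_ne_top_iff [IsFiniteMeasure P] [IsFiniteMeasure R] (h : HasDensity P R q) :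
    klDiv P R ≠ ∞ ↔ Integrable (fun z => klFun (q z)) R := by
  rw [h.klDiv_eq]
  exact lintegral_ofReal_ne_top_iff_integrable h.measurable_klFun_comp.aestronglyMeasurable
    (ae_of_all _ fun z => klFun_nonneg (h.nonneg z))

theorem toReal_klDiv [IsFiniteMeasure P] [IsFiniteMeasure R] (h : HasDensity P R q) :
    (klDiv P R).toReal = ∫ z, klFun (q z) ∂ R := by
  rw [h.klDiv_eq, integral_eq_lintegral_of_nonneg_ae
    (ae_of_all _ fun z => klFun_nonneg (h.nonneg z)) h.measurable_klFun_comp.aestronglyMeasurable]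

theorem mix {P Q : ProbabilityMeasure Z} {p q : Z → ℝ} (hp : HasDensity (P : Measure Z) R p)
    (hq : HasDensity (Q : Measure Z) R q) (t : I) :
    HasDensity (EntropicOT.mix t P Q : Measure Z) R
      (fun z => (1 - (t : ℝ)) * p z + (t : ℝ) * q z) where
  measurable := (hp.measurable.const_mul _).add (hq.measurable.const_mul _)
  nonneg z := add_nonneg (mul_nonneg (sub_nonneg.2 t.2.2) (hp.nonneg z))
    (mul_nonneg t.2.1 (hq.nonneg z))
  eq := by
    change ENNReal.ofReal (1 - (t : ℝ)) • (P : Measure Z) +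
      ENNReal.ofReal (t : ℝ) • (Q : Measure Z) = _
    have : (fun z => ENNReal.ofReal ((1 - (t : ℝ)) * p z + (t : ℝ) * q z)) =
        ENNReal.ofReal (1 - (t : ℝ)) • (fun z => ENNReal.ofReal (p z)) +
          ENNReal.ofReal (t : ℝ) • (fun z => ENNReal.ofReal (q z)) := by
      ext z
      simp only [Pi.add_apply, Pi.smul_apply, smul_eq_mul]
      rw [← ENNReal.ofReal_mul (sub_nonneg.2 t.2.2), ← ENNReal.ofReal_mul t.2.1,
        ENNReal.ofReal_add (mul_nonneg (sub_nonneg.2 t.2.2) (hp.nonneg z))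
        (mul_nonneg t.2.1 (hq.nonneg z))]
    rw [this, withDensity_add_left (hp.measurable.ennreal_ofReal.const_smul _),
      withDensity_smul _ hp.measurable.ennreal_ofReal,
      withDensity_smul _ hq.measurable.ennreal_ofReal, ← hp.eq, ← hq.eq]

end HasDensity

/-- The probability measure with a given density of total mass one. -/
theorem exists_probabilityMeasure_hasDensity {R : Measure Z} {q : Z → ℝ} (hm : Measurable q)
    (h0 : ∀ z, 0 ≤ q z) (hi : Integrable q R) (h1 : ∫ z, q z ∂ R = 1) :
    ∃ Q : ProbabilityMeasure Z, HasDensity (Q : Measure Z) R q := by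
  refine ⟨⟨R.withDensity fun z => ENNReal.ofReal (q z), ⟨?_⟩⟩, hm, h0, rfl⟩
  rw [withDensity_apply _ MeasurableSet.univ, setLIntegral_univ,
    ← ofReal_integral_eq_lintegral_ofReal hi (ae_of_all _ h0), h1, ENNReal.ofReal_one]

theorem coe_mix (t : I) (P Q : ProbabilityMeasure Z) : (mix t P Q : Measure Z) =
    ENNReal.ofReal (1 - (t : ℝ)) • (P : Measure Z) + ENNReal.ofReal (t : ℝ) • (Q : Measure Z) :=
  rfl

theorem integral_mix (t : I) (P Q : ProbabilityMeasure Z) {h : Z → ℝ}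
    (hP : Integrable h (P : Measure Z)) (hQ : Integrable h (Q : Measure Z)) :
    ∫ z, h z ∂(mix t P Q : Measure Z) =
      (1 - (t : ℝ)) * ∫ z, h z ∂(P : Measure Z) + (t : ℝ) * ∫ z, h z ∂(Q : Measure Z) := by
  rw [coe_mix, integral_add_measure (hP.smul_measure ENNReal.ofReal_ne_top)
    (hQ.smul_measure ENNReal.ofReal_ne_top), integral_smul_measure, integral_smul_measure,
    ENNReal.toReal_ofReal (sub_nonneg.2 t.2.2), ENNReal.toReal_ofReal t.2.1]
  rfl

theorem mix_mix (s t : I) (P Q : ProbabilityMeasure Z) :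
    mix s P (mix t P Q) = mix (s * t) P Q := by
  apply Subtype.ext
  change (mix s P (mix t P Q) : Measure Z) = (mix (s * t) P Q : Measure Z)
  rw [coe_mix, coe_mix, coe_mix, smul_add, ← add_assoc, smul_smul, smul_smul, ← add_smul,
    ← ENNReal.ofReal_mul s.2.1, ← ENNReal.ofReal_mul s.2.1,
    ← ENNReal.ofReal_add (sub_nonneg.2 s.2.2) (mul_nonneg s.2.1 (sub_nonneg.2 t.2.2)),
    Set.Icc.coe_mul]
  congr 3
  ring

theorem mix_zero (P Q : ProbabilityMeasure Z) : mix 0 P Q = P := by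
  apply Subtype.ext
  change (mix 0 P Q : Measure Z) = (P : Measure Z)
  simp [coe_mix]

theorem mix_mem_couplings {X Y : Type*} [MeasurableSpace X] [MeasurableSpace Y]
    {μ : ProbabilityMeasure X} {ν : ProbabilityMeasure Y} {P Q : ProbabilityMeasure (X × Y)}
    (hP : P ∈ couplings μ ν) (hQ : Q ∈ couplings μ ν) (t : I) : mix t P Q ∈ couplings μ ν := by
  have h1 : ENNReal.ofReal (1 - (t : ℝ)) + ENNReal.ofReal (t : ℝ) = 1 := by
    rw [← ENNReal.ofReal_add (sub_nonneg.2 t.2.2) t.2.1]; simp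
  constructor
  · rw [coe_mix, Measure.map_add _ _ measurable_fst, Measure.map_smul, Measure.map_smul, hP.1,
      hQ.1, ← add_smul, h1, one_smul]
  · rw [coe_mix, Measure.map_add _ _ measurable_snd, Measure.map_smul, Measure.map_smul, hP.2,
      hQ.2, ← add_smul, h1, one_smul]

theorem mem_couplings_of_measureReal_eq {X Y : Type*} [MeasurableSpace X] [MeasurableSpace Y]
    {μ : ProbabilityMeasure X} {ν : ProbabilityMeasure Y} {P Q : ProbabilityMeasure (X × Y)}
    (hP : P ∈ couplings μ ν)
    (h1 : ∀ A : Set X, MeasurableSet A → (Q : Measure (X × Y)).real (Prod.fst ⁻¹' A) =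
      (P : Measure (X × Y)).real (Prod.fst ⁻¹' A))
    (h2 : ∀ B : Set Y, MeasurableSet B → (Q : Measure (X × Y)).real (Prod.snd ⁻¹' B) =
      (P : Measure (X × Y)).real (Prod.snd ⁻¹' B)) : Q ∈ couplings μ ν := by
  constructor
  · rw [← hP.1]
    ext A hA
    rw [Measure.map_apply measurable_fst hA, Measure.map_apply measurable_fst hA]
    exact (measureReal_eq_measureReal_iff).1 (h1 A hA)
  · rw [← hP.2]
    ext A hA
    rw [Measure.map_apply measurable_snd hA, Measure.map_apply measurable_snd hA]
    exact (measureReal_eq_measureReal_iff).1 (h2 A hA)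

end Density

/-! ### Scalar inequalities for the entropy function -/

section KlFun

/-- Apply `log u ≤ u - 1` at `u = 1 / √x` and multiply by `2 x`. This is the pointwise form of the
bound of squared Hellinger distance by entropy. -/
theorem sq_sqrt_sub_one_le_klFun {x : ℝ} (hx : 0 ≤ x) : (√x - 1) ^ 2 ≤ klFun x := by
  rcases hx.eq_or_lt with rfl | hx
  · simp [klFun_zero]
  have hs : 0 < √x := Real.sqrt_pos.2 hx
  have h1 : Real.log (√x)⁻¹ ≤ (√x)⁻¹ - 1 := Real.log_le_sub_one_of_pos (inv_pos.2 hs)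
  rw [Real.log_inv, Real.log_sqrt hx.le] at h1
  have h2 : x * (√x)⁻¹ = √x := by rw [← div_eq_mul_inv, Real.div_sqrt]
  have h3 : √x ^ 2 = x := Real.sq_sqrt hx.le
  rw [klFun_apply]
  nlinarith [mul_le_mul_of_nonneg_left h1 hx.le]

/-- The right side is the Bregman divergence of `klFun`, whose derivative is `log`; the left side is
the integrand of a relative entropy between two densities. -/
theorem mul_klFun_div {m x : ℝ} (hm : 0 < m) (hx : 0 ≤ x) :
    m * klFun (x / m) = klFun x - klFun m - Real.log m * (x - m) := by
  rcases hx.eq_or_lt with rfl | hx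
  · simp [klFun_apply]; ring
  rw [klFun_apply, klFun_apply, klFun_apply, Real.log_div hx.ne' hm.ne']
  field_simp
  ring

/-- The Bregman divergences of `a` and `b` from their midpoint average to the Jensen gap, since the
linear terms cancel. Each dominates a squared difference of square roots, and the parallelogram
identity removes the midpoint. -/
theorem sq_sqrt_sub_sqrt_le {a b : ℝ} (ha : 0 ≤ a) (hb : 0 ≤ b) :
    (√a - √b) ^ 2 / 4 ≤ (klFun a + klFun b) / 2 - klFun ((1 - 1 / 2) * a + 1 / 2 * b) := by
  set m : ℝ := (1 - 1 / 2) * a + 1 / 2 * b with hm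
  rcases (show 0 ≤ m by rw [hm]; linarith).eq_or_lt with h0 | h0
  · have ha0 : a = 0 := by linarith
    have hb0 : b = 0 := by linarith
    rw [← h0, ha0, hb0]; simp
  have key : ∀ x, 0 ≤ x → (√x - √m) ^ 2 ≤ m * klFun (x / m) := by
    intro x hx
    have h := mul_le_mul_of_nonneg_left (sq_sqrt_sub_one_le_klFun (div_nonneg hx h0.le)) h0.le
    rw [Real.sqrt_div hx] at h
    have hs : 0 < √m := Real.sqrt_pos.2 h0
    have h3 : √m ^ 2 = m := Real.sq_sqrt h0.le
    have : m * (√x / √m - 1) ^ 2 = (√x - √m) ^ 2 := by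
      nth_rewrite 1 [← h3]
      field_simp
    linarith
  have h1 := key a ha
  have h2 := key b hb
  rw [mul_klFun_div h0 ha] at h1
  rw [mul_klFun_div h0 hb] at h2
  have h3 : Real.log m * (a - m) + Real.log m * (b - m) = 0 := by rw [hm]; ring
  nlinarith [sq_nonneg (√a + √b - 2 * √m)]

/-- Quantitative midpoint convexity of `klFun`. -/
theorem abs_sub_le_midpoint_klFun {a b l : ℝ} (ha : 0 ≤ a) (hb : 0 ≤ b) (hl : 0 < l) :
    |a - b| ≤ l * (a + b) +
      2 / l * ((klFun a + klFun b) / 2 - klFun ((1 - 1 / 2) * a + 1 / 2 * b)) := by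
  have h := mul_le_mul_of_nonneg_left (sq_sqrt_sub_sqrt_le ha hb) (div_pos two_pos hl).le
  refine le_trans ?_ (add_le_add_right h _)
  have e : |a - b| = |√a - √b| * (√a + √b) := by
    rw [← abs_of_nonneg (add_nonneg (Real.sqrt_nonneg a) (Real.sqrt_nonneg b)), ← abs_mul]
    congr 1
    nlinarith [Real.sq_sqrt ha, Real.sq_sqrt hb]
  have e2 : a + b ≥ (√a + √b) ^ 2 / 2 := by
    nlinarith [Real.sq_sqrt ha, Real.sq_sqrt hb, sq_nonneg (√a - √b)]
  rw [e, ← sq_abs (√a - √b)]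
  set u := |√a - √b|
  set v := √a + √b
  -- Weighted AM-GM for the product `u v = |a - b|`, written as a complete square.
  have : l * (v ^ 2 / 2) + 2 / l * (u ^ 2 / 4) - u * v = (l * v - u) ^ 2 / (2 * l) := by
    field_simp; ring
  have h3 : 0 ≤ (l * v - u) ^ 2 / (2 * l) := by positivity
  nlinarith [mul_le_mul_of_nonneg_left e2 hl.le]

theorem klFun_mix_le {t : ℝ} (h0 : 0 ≤ t) (h1 : t ≤ 1) {a b : ℝ} (ha : 0 ≤ a) (hb : 0 ≤ b) :
    klFun ((1 - t) * a + t * b) ≤ (1 - t) * klFun a + t * klFun b :=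
  convexOn_klFun.2 ha hb (sub_nonneg.2 h1) h0 (by ring)

/-- The convexity inequality of `klFun`, with the gain at a zero of the first argument. -/
theorem klFun_mix_le_of_eq_zero {t : ℝ} (h0 : 0 < t) {b : ℝ} (hb : 0 ≤ b) :
    klFun ((1 - t) * 0 + t * b) = (1 - t) * klFun 0 + t * klFun b + t * Real.log t * b := by
  rcases hb.eq_or_lt with rfl | hb
  · simp [klFun_zero]
  simp only [mul_zero, zero_add, klFun_apply, Real.log_mul h0.ne' hb.ne']
  ring

/-- An exact expansion in `s`: the first-order term is explicit and the remainder `p * klFun (1 +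
s)` is quadratic by `klFun_one_add_le`. It also holds at `p = 0`. -/
theorem klFun_mul_one_add {p s : ℝ} (hs : -1 < s) :
    klFun (p * (1 + s)) = klFun p + s * (p * Real.log p) + p * klFun (1 + s) := by
  rcases eq_or_ne p 0 with rfl | hp
  · simp
  have h2 : (1 + s) ≠ 0 := by linarith
  simp only [klFun_apply, Real.log_mul hp h2]
  ring

theorem klFun_one_add_le {s : ℝ} (hs : -1 < s) : klFun (1 + s) ≤ s ^ 2 := by
  have := Real.log_le_sub_one_of_pos (show 0 < 1 + s by linarith)
  rw [klFun_apply]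
  nlinarith

/-- Young's inequality for the positive part of the logarithm. -/
theorem mul_posLog_le {q p : ℝ} (hq : 0 ≤ q) (hp : 0 ≤ p) :
    q * Real.posLog p ≤ klFun q + p := by
  rcases hq.eq_or_lt with rfl | hq
  · simp only [zero_mul, klFun_zero]; linarith
  have hm : 0 < max 1 p := lt_max_of_lt_left one_pos
  rw [Real.posLog_eq_log_max_one hp]
  have h1 := Real.log_le_sub_one_of_pos (div_pos hm hq)
  rw [Real.log_div hm.ne' hq.ne'] at h1
  have h2 := mul_le_mul_of_nonneg_left h1 hq.le
  have h3 : q * (max 1 p / q - 1) = max 1 p - q := by field_simp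
  have h4 : max 1 p ≤ 1 + p := max_le (by linarith) (by linarith)
  rw [klFun_apply]
  linarith

end KlFun

/-! ### Limits of sums `f x + g y` -/

section ClosedSums

variable {X Y : Type*} [MeasurableSpace X] [MeasurableSpace Y]

/-- Countably many sections of `S` cover every section up to a null set. -/
theorem exists_seq_measure_section_diff_eq_zero [Nonempty X] (ν : Measure Y) [IsFiniteMeasure ν]
    {S : Set (X × Y)} (hS : MeasurableSet S) :
    ∃ x : ℕ → X, ∀ a : X, ν (Prod.mk a ⁻¹' S \ ⋃ i, Prod.mk (x i) ⁻¹' S) = 0 := by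
  have hm : ∀ a, MeasurableSet (Prod.mk a ⁻¹' S) := fun a => measurable_prodMk_left hS
  set m : (ℕ → X) → ℝ≥0∞ := fun x => ν (⋃ i, Prod.mk (x i) ⁻¹' S) with hmdef
  -- The supremum of the measures of countable unions of sections is attained, by merging a
  -- maximizing sequence of families into one family.
  obtain ⟨u, -, hu, hmem⟩ := exists_seq_tendsto_sSup (range_nonempty m) (OrderTop.bddAbove _)
  choose v hv using hmem
  set x : ℕ → X := fun n => v n.unpair.1 n.unpair.2 with hx
  have hsup : sSup (range m) ≤ m x := by
    refine le_of_tendsto' hu fun n => ?_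
    rw [← hv n]
    refine measure_mono (iUnion_subset fun i => ?_)
    refine subset_iUnion_of_subset (Nat.pair n i) ?_
    simp [hx]
  refine ⟨x, fun a => ?_⟩
  set U := ⋃ i, Prod.mk (x i) ⁻¹' S with hU
  have hUm : MeasurableSet U := MeasurableSet.iUnion fun i => hm _
  -- Adjoining `a` to a maximizing family cannot increase the measure of the union.
  set x' : ℕ → X := fun n => Nat.casesOn n a x with hx'
  have h1 : Prod.mk a ⁻¹' S ∪ U ⊆ ⋃ i, Prod.mk (x' i) ⁻¹' S :=
    union_subset (subset_iUnion_of_subset 0 subset_rfl)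
      (iUnion_subset fun i => subset_iUnion_of_subset (i + 1) subset_rfl)
  have h2 : ν (Prod.mk a ⁻¹' S ∪ U) ≤ ν U :=
    (measure_mono h1).trans ((le_sSup (mem_range_self x')).trans hsup)
  have h3 : ν (Prod.mk a ⁻¹' S \ U) + ν U ≤ 0 + ν U := by
    rw [← measure_union disjoint_sdiff_left hUm, sdiff_union_self, zero_add]
    exact h2
  exact le_antisymm ((ENNReal.add_le_add_iff_right (measure_ne_top ν U)).1 h3) zero_le

open scoped Classical in
/-- The limit of the first convergent sequence among countably many sequences of functions, and
zero if there is none. -/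
noncomputable def firstLimit {A : Type*} (u : ℕ → ℕ → A → ℝ) (a : A) : ℝ :=
  if h : ∃ i, ∃ l, Tendsto (fun n => u i n a) atTop (𝓝 l) then
    limUnder atTop (fun n => u (Nat.find h) n a) else 0

theorem measurable_firstLimit {A : Type*} [MeasurableSpace A] {u : ℕ → ℕ → A → ℝ}
    (hu : ∀ i n, Measurable (u i n)) : Measurable (firstLimit u) := by
  classical
  have hc : ∀ i, MeasurableSet {a | ∃ l, Tendsto (fun n => u i n a) atTop (𝓝 l)} := fun i =>
    MeasureTheory.measurableSet_exists_tendsto (hu i)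
  have hl : ∀ i, Measurable fun a => limUnder atTop (fun n => u i n a) := fun i =>
    (StronglyMeasurable.limUnder fun n => (hu i n).stronglyMeasurable).measurable
  set C : Set A := {a | ∃ i, ∃ l, Tendsto (fun n => u i n a) atTop (𝓝 l)}
  have hC : MeasurableSet C := by
    have : C = ⋃ i, {a | ∃ l, Tendsto (fun n => u i n a) atTop (𝓝 l)} := by
      ext a; simp [C]
    rw [this]
    exact MeasurableSet.iUnion hc
  refine Measurable.dite (s := C)
    (f := fun a : C => limUnder atTop (fun n => u (Nat.find a.2) n a.1)) (g := fun _ => 0) ?_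
    measurable_const hC
  have hmeas : Measurable fun p : ℕ × C => limUnder atTop (fun n => u p.1 n p.2.1) :=
    measurable_from_prod_countable_right fun i => (hl i).comp measurable_subtype_coe
  have hfind : Measurable fun a : C => Nat.find a.2 :=
    measurable_find (p := fun (a : C) i => ∃ l, Tendsto (fun n => u i n a.1) atTop (𝓝 l))
      (fun a => a.2) fun i => measurable_subtype_coe (hc i)
  exact hmeas.comp (hfind.prodMk measurable_id)

/-- If `f n (x) + g n (y)` converges `P`-a.e., where `P ≪ μ ⊗ ν`, then the limit is of the same
form. -/
theorem exists_add_of_ae_tendsto {μ : Measure X} {ν : Measure Y} [SFinite μ]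
    [IsFiniteMeasure ν] {P : Measure (X × Y)} (hP : P ≪ μ.prod ν) [Nonempty X]
    {f : ℕ → X → ℝ} {g : ℕ → Y → ℝ} (hf : ∀ n, Measurable (f n)) (hg : ∀ n, Measurable (g n))
    {φ : X × Y → ℝ}
    (h : ∀ᵐ z ∂P, Tendsto (fun n => f n z.1 + g n z.2) atTop (𝓝 (φ z))) :
    ∃ (f' : X → ℝ) (g' : Y → ℝ), Measurable f' ∧ Measurable g' ∧
      ∀ᵐ z ∂P, φ z = f' z.1 + g' z.2 := by
  obtain ⟨S, hSsub, hSm, hS0⟩ : ∃ S : Set (X × Y),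
      (∀ z ∈ S, Tendsto (fun n => f n z.1 + g n z.2) atTop (𝓝 (φ z))) ∧
      MeasurableSet S ∧ ∀ᵐ z ∂P, z ∈ S := by
    refine ⟨(toMeasurable P {z | ¬ Tendsto (fun n => f n z.1 + g n z.2) atTop (𝓝 (φ z))})ᶜ,
      fun z hz => ?_, (measurableSet_toMeasurable _ _).compl, ?_⟩
    · by_contra hcon
      exact hz (subset_toMeasurable _ _ hcon)
    · rw [ae_iff] at h ⊢
      simpa using h
  obtain ⟨x, hx⟩ := exists_seq_measure_section_diff_eq_zero ν hSm
  -- The part of `S` over the uncovered `y` has null sections, so it is null for `μ ⊗ ν` by Fubini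
  -- and then for `P`.
  have hcov : ∀ᵐ z ∂P, ∃ i, (x i, z.2) ∈ S := by
    have hN : MeasurableSet (S ∩ Prod.snd ⁻¹' (⋃ i, Prod.mk (x i) ⁻¹' S)ᶜ) :=
      hSm.inter (measurable_snd
        (MeasurableSet.iUnion fun i => measurable_prodMk_left hSm).compl)
    have h0 : P (S ∩ Prod.snd ⁻¹' (⋃ i, Prod.mk (x i) ⁻¹' S)ᶜ) = 0 := by
      refine hP ?_
      rw [Measure.prod_apply hN]
      refine (lintegral_congr fun a => ?_).trans lintegral_zero
      rw [← hx a]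
      congr 1
    filter_upwards [hS0, measure_eq_zero_iff_ae_notMem.1 h0] with z hz hz'
    by_contra hcon
    exact hz' ⟨hz, by simpa using hcon⟩
  -- `f n` and `g n` may diverge by opposite constants; subtracting the value at the base point `x
  -- i` removes this freedom wherever `(x i, y)` is also a point of convergence.
  set u : ℕ → ℕ → X → ℝ := fun i n a => f n a - f n (x i) with hu
  set v : ℕ → ℕ → Y → ℝ := fun i n b => g n b + f n (x i) with hv
  refine ⟨firstLimit u, firstLimit v,
    measurable_firstLimit fun i n => (hf n).sub_const _,
    measurable_firstLimit fun i n => (hg n).add_const _, ?_⟩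
  classical
  filter_upwards [hS0, hcov] with z hz ⟨i, hi⟩
  have hlim := hSsub z hz
  -- As `u j + v j` converges to `φ z`, both terms converge for the same `j`. Hence the two first
  -- limits select the same base point, although each depends on one variable only.
  have huv : ∀ j, (∃ l, Tendsto (fun n => u j n z.1) atTop (𝓝 l)) ↔
      ∃ l, Tendsto (fun n => v j n z.2) atTop (𝓝 l) := by
    refine fun j => ⟨fun ⟨l, hl⟩ => ⟨φ z - l, ?_⟩, fun ⟨l, hl⟩ => ⟨φ z - l, ?_⟩⟩
    · refine (hlim.sub hl).congr fun n => ?_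
      simp only [hu, hv]; ring
    · refine (hlim.sub hl).congr fun n => ?_
      simp only [hu, hv]; ring
  have hex : ∃ j, ∃ l, Tendsto (fun n => u j n z.1) atTop (𝓝 l) := by
    refine ⟨i, φ z - φ (x i, z.2), (hlim.sub (hSsub _ hi)).congr fun n => ?_⟩
    simp only [hu]; ring
  have hex' : ∃ j, ∃ l, Tendsto (fun n => v j n z.2) atTop (𝓝 l) := by
    obtain ⟨j, hj⟩ := hex
    exact ⟨j, (huv j).1 hj⟩
  have hfind : Nat.find hex = Nat.find hex' := Nat.find_congr' (fun {j} => huv j)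
  rw [firstLimit, firstLimit, dif_pos hex, dif_pos hex', hfind]
  obtain ⟨l, hl⟩ := Nat.find_spec hex'
  obtain ⟨l', hl'⟩ := (huv _).2 ⟨l, hl⟩
  rw [hl.limUnder_eq, hl'.limUnder_eq]
  refine tendsto_nhds_unique hlim ((hl'.add hl).congr fun n => ?_)
  simp only [hu, hv]; ring

end ClosedSums

/-! ### Integrals of `f ⊕ g` under couplings -/

section Truncation

/-- Truncation of a real number to `[-n, n]`. -/
def trunc (n : ℕ) (x : ℝ) : ℝ := max (-(n : ℝ)) (min n x)

theorem abs_trunc_le (n : ℕ) (x : ℝ) : |trunc n x| ≤ n := by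
  have : (0 : ℝ) ≤ n := n.cast_nonneg
  rw [abs_le]
  exact ⟨le_max_left _ _, max_le (by linarith) (min_le_left _ _)⟩

theorem measurable_trunc (n : ℕ) : Measurable (trunc n) := by
  unfold trunc; fun_prop

theorem trunc_neg (n : ℕ) (x : ℝ) : trunc n (-x) = -trunc n x := by
  have : (0 : ℝ) ≤ n := n.cast_nonneg
  simp only [trunc]
  grind

theorem trunc_sub_trunc_mono (n : ℕ) {x y : ℝ} (h : y ≤ x) :
    0 ≤ trunc n x - trunc n y ∧
      trunc n x - trunc n y ≤ trunc (n + 1) x - trunc (n + 1) y := by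
  have : (0 : ℝ) ≤ n := n.cast_nonneg
  simp only [trunc, Nat.cast_add, Nat.cast_one]
  constructor <;> grind

theorem trunc_eventually_eq (x : ℝ) : ∀ᶠ n in atTop, trunc n x = x := by
  obtain ⟨N, hN⟩ := exists_nat_ge |x|
  filter_upwards [eventually_ge_atTop N] with n hn
  have hn' : |x| ≤ n := hN.trans (by exact_mod_cast hn)
  rw [abs_le] at hn'
  rw [trunc, min_eq_right hn'.2, max_eq_right hn'.1]

/-- Since `trunc n` is odd, the sum is `trunc n x - trunc n (-y)`: its sign is that of `x + y`, and
its size grows with `n`. This makes monotone convergence available for each part of `f ⊕ g` without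
integrability of `f` or `g`. -/
theorem ofReal_trunc_add_monotone (x y : ℝ) :
    Monotone fun n : ℕ => ENNReal.ofReal (trunc n x + trunc n y) := by
  refine monotone_nat_of_le_succ fun n => ?_
  have hy : ∀ m, trunc m y = -trunc m (-y) := fun m => by rw [trunc_neg, neg_neg]
  rcases le_total (-y) x with h | h
  · refine ENNReal.ofReal_le_ofReal ?_
    rw [hy, hy]
    linarith [(trunc_sub_trunc_mono n h).2]
  · refine (ENNReal.ofReal_of_nonpos ?_).trans_le zero_le
    rw [hy]
    linarith [(trunc_sub_trunc_mono n h).1]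

variable {X Y : Type*} [MeasurableSpace X] [MeasurableSpace Y] {μ : ProbabilityMeasure X}
  {ν : ProbabilityMeasure Y}

theorem integral_add_eq_of_mem_couplings {P Q : ProbabilityMeasure (X × Y)}
    (hP : P ∈ couplings μ ν) (hQ : Q ∈ couplings μ ν) {f : X → ℝ} {g : Y → ℝ} (hf : Measurable f)
    (hg : Measurable g) {C : ℝ} (hfC : ∀ x, |f x| ≤ C) (hgC : ∀ y, |g y| ≤ C) :
    ∫ z, f z.1 + g z.2 ∂(P : Measure (X × Y)) = ∫ z, f z.1 + g z.2 ∂(Q : Measure (X × Y)) := by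
  have key : ∀ P : ProbabilityMeasure (X × Y), P ∈ couplings μ ν →
      ∫ z, f z.1 + g z.2 ∂(P : Measure (X × Y)) =
        ∫ x, f x ∂(μ : Measure X) + ∫ y, g y ∂(ν : Measure Y) := by
    intro P hP
    rw [integral_add, ← hP.1, ← hP.2, integral_map measurable_fst.aemeasurable
      hf.aestronglyMeasurable, integral_map measurable_snd.aemeasurable hg.aestronglyMeasurable]
    · exact Integrable.of_bound (hf.comp measurable_fst).aestronglyMeasurable C
        (ae_of_all _ fun z => hfC z.1)
    · exact Integrable.of_bound (hg.comp measurable_snd).aestronglyMeasurable C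
        (ae_of_all _ fun z => hgC z.2)
  rw [key P hP, key Q hQ]

/-- If `f ⊕ g` has a `Q`-integrable positive part and a `P`-integrable negative part, where `P` and
`Q` have the same marginals, then it is integrable for both, with the same integral. -/
theorem integral_add_eq_of_integrable_parts {P Q : ProbabilityMeasure (X × Y)}
    (hP : P ∈ couplings μ ν) (hQ : Q ∈ couplings μ ν) {f : X → ℝ} {g : Y → ℝ} (hf : Measurable f)
    (hg : Measurable g)
    (hpos : ∫⁻ z, ENNReal.ofReal (f z.1 + g z.2) ∂(Q : Measure (X × Y)) ≠ ∞)
    (hneg : ∫⁻ z, ENNReal.ofReal (-(f z.1 + g z.2)) ∂(P : Measure (X × Y)) ≠ ∞) :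
    Integrable (fun z => f z.1 + g z.2) (P : Measure (X × Y)) ∧
    Integrable (fun z => f z.1 + g z.2) (Q : Measure (X × Y)) ∧
    ∫ z, f z.1 + g z.2 ∂(P : Measure (X × Y)) = ∫ z, f z.1 + g z.2 ∂(Q : Measure (X × Y)) := by
  have hm : Measurable fun z : X × Y => f z.1 + g z.2 :=
    (hf.comp measurable_fst).add (hg.comp measurable_snd)
  have hmn : ∀ n, Measurable fun z : X × Y => trunc n (f z.1) + trunc n (g z.2) := fun n =>
    ((measurable_trunc n).comp (hf.comp measurable_fst)).add
      ((measurable_trunc n).comp (hg.comp measurable_snd))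
  have lim1 : ∀ P : Measure (X × Y), Tendsto
      (fun n => ∫⁻ z, ENNReal.ofReal (trunc n (f z.1) + trunc n (g z.2)) ∂P) atTop
      (𝓝 (∫⁻ z, ENNReal.ofReal (f z.1 + g z.2) ∂P)) := by
    intro P
    refine lintegral_tendsto_of_tendsto_of_monotone
      (fun n => (hmn n).ennreal_ofReal.aemeasurable)
      (ae_of_all _ fun z => ofReal_trunc_add_monotone _ _) (ae_of_all _ fun z => ?_)
    refine tendsto_const_nhds.congr' ?_
    filter_upwards [trunc_eventually_eq (f z.1), trunc_eventually_eq (g z.2)] with n h1 h2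
    rw [h1, h2]
  have lim2 : ∀ P : Measure (X × Y), Tendsto
      (fun n => ∫⁻ z, ENNReal.ofReal (-(trunc n (f z.1) + trunc n (g z.2))) ∂P) atTop
      (𝓝 (∫⁻ z, ENNReal.ofReal (-(f z.1 + g z.2)) ∂P)) := by
    intro P
    refine lintegral_tendsto_of_tendsto_of_monotone
      (fun n => (hmn n).neg.ennreal_ofReal.aemeasurable)
      (ae_of_all _ fun z => ?_) (ae_of_all _ fun z => ?_)
    · simp only [neg_add, ← trunc_neg]
      exact ofReal_trunc_add_monotone _ _
    · refine tendsto_const_nhds.congr' ?_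
      filter_upwards [trunc_eventually_eq (f z.1), trunc_eventually_eq (g z.2)] with n h1 h2
      rw [h1, h2]
  -- The equality of truncated integrals, rearranged so that no subtraction occurs and the two parts
  -- assumed finite in the limit stand on the same side.
  have heq : ∀ n, ∫⁻ z, ENNReal.ofReal (trunc n (f z.1) + trunc n (g z.2)) ∂(Q : Measure (X × Y))
      + ∫⁻ z, ENNReal.ofReal (-(trunc n (f z.1) + trunc n (g z.2))) ∂(P : Measure (X × Y)) =
      ∫⁻ z, ENNReal.ofReal (trunc n (f z.1) + trunc n (g z.2)) ∂(P : Measure (X × Y))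
      + ∫⁻ z, ENNReal.ofReal (-(trunc n (f z.1) + trunc n (g z.2))) ∂(Q : Measure (X × Y)) := by
    intro n
    have hi : ∀ P : ProbabilityMeasure (X × Y),
        Integrable (fun z => trunc n (f z.1) + trunc n (g z.2)) (P : Measure (X × Y)) := fun P =>
      Integrable.of_bound (hmn n).aestronglyMeasurable (n + n) (ae_of_all _ fun z =>
        (abs_add_le _ _).trans (add_le_add (abs_trunc_le _ _) (abs_trunc_le _ _)))
    have h := integral_add_eq_of_mem_couplings hP hQ ((measurable_trunc n).comp hf)
      ((measurable_trunc n).comp hg) (fun x => abs_trunc_le n (f x)) (fun y => abs_trunc_le n (g y))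
    simp only [Function.comp_apply] at h
    rw [integral_eq_lintegral_pos_part_sub_lintegral_neg_part (hi P),
      integral_eq_lintegral_pos_part_sub_lintegral_neg_part (hi Q)] at h
    have t1 := fun P => (hi P).lintegral_lt_top.ne
    have t2 := fun P => (hi P).neg.lintegral_lt_top.ne
    simp only [Pi.neg_apply] at t2
    rw [← ENNReal.toReal_eq_toReal_iff' (ENNReal.add_ne_top.2 ⟨t1 _, t2 _⟩)
      (ENNReal.add_ne_top.2 ⟨t1 _, t2 _⟩), ENNReal.toReal_add (t1 _) (t2 _),
      ENNReal.toReal_add (t1 _) (t2 _)]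
    linarith
  have hfin := tendsto_nhds_unique (((lim1 Q).add (lim2 P)).congr heq) ((lim1 P).add (lim2 Q))
  have hsum : ∫⁻ z, ENNReal.ofReal (f z.1 + g z.2) ∂(P : Measure (X × Y)) +
      ∫⁻ z, ENNReal.ofReal (-(f z.1 + g z.2)) ∂(Q : Measure (X × Y)) ≠ ∞ :=
    hfin ▸ ENNReal.add_ne_top.2 ⟨hpos, hneg⟩
  obtain ⟨hp, hq⟩ := ENNReal.add_ne_top.1 hsum
  have hint : ∀ P : Measure (X × Y), ∫⁻ z, ENNReal.ofReal (f z.1 + g z.2) ∂P ≠ ∞ →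
      ∫⁻ z, ENNReal.ofReal (-(f z.1 + g z.2)) ∂P ≠ ∞ → Integrable (fun z => f z.1 + g z.2) P := by
    intro P h1 h2
    refine ⟨hm.aestronglyMeasurable, ?_⟩
    rw [hasFiniteIntegral_iff_norm]
    have : ∀ x : ℝ, ENNReal.ofReal ‖x‖ = ENNReal.ofReal x + ENNReal.ofReal (-x) := by
      intro x
      rcases le_total 0 x with h | h
      · rw [Real.norm_of_nonneg h, ENNReal.ofReal_of_nonpos (neg_nonpos.2 h), add_zero]
      · rw [Real.norm_of_nonpos h, ENNReal.ofReal_of_nonpos h, zero_add]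
    simp only [this]
    rw [lintegral_add_left hm.ennreal_ofReal]
    exact (ENNReal.add_ne_top.2 ⟨h1, h2⟩).lt_top
  have iP := hint _ hp hneg
  have iQ := hint _ hpos hq
  refine ⟨iP, iQ, ?_⟩
  rw [integral_eq_lintegral_pos_part_sub_lintegral_neg_part iP,
    integral_eq_lintegral_pos_part_sub_lintegral_neg_part iQ]
  have := congrArg ENNReal.toReal hfin
  rw [ENNReal.toReal_add hpos hneg, ENNReal.toReal_add hp hq] at this
  linarith

end Truncation

/-! ### Duality in `L¹` and orthogonality -/

section LOneDuality

variable {Z : Type*} [MeasurableSpace Z]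

theorem integrable_toL1_sub_norm_eq {P : Measure Z} {f g : Z → ℝ} (hf : Integrable f P)
    (hg : Integrable g P) : ‖hf.toL1 f - hg.toL1 g‖ = ∫ z, |f z - g z| ∂P := by
  rw [← Integrable.toL1_sub, L1.norm_of_fun_eq_integral_norm]
  rfl

theorem tendsto_toL1_trunc {P : Measure Z} [IsFiniteMeasure P] {f : Z → ℝ} (hf : Integrable f P)
    (hn : ∀ n, Integrable (fun z => trunc n (f z)) P) :
    Tendsto (fun n => (hn n).toL1 (fun z => trunc n (f z))) atTop (𝓝 (hf.toL1 f)) := by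
  rw [tendsto_iff_norm_sub_tendsto_zero]
  simp only [integrable_toL1_sub_norm_eq]
  have : (0 : ℝ) = ∫ _, (0 : ℝ) ∂P := by simp
  rw [this]
  refine tendsto_integral_of_dominated_convergence (fun z => |f z|)
    (fun n => ((hn n).sub hf).abs.aestronglyMeasurable) hf.abs
    (fun n => ae_of_all _ fun z => ?_) (ae_of_all _ fun z => ?_)
  · have : (0 : ℝ) ≤ n := n.cast_nonneg
    simp only [trunc, Real.norm_eq_abs, abs_abs]
    grind
  · refine tendsto_const_nhds.congr' ?_
    filter_upwards [trunc_eventually_eq (f z)] with n h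
    rw [h]; simp

/-- A continuous linear functional on `L¹` of a probability measure is the integral against a
bounded function. -/
theorem exists_bounded_repr_of_dual_L1 {P : Measure Z} [IsProbabilityMeasure P]
    (ℓ : StrongDual ℝ (Lp ℝ 1 P)) :
    ∃ k : Z → ℝ, Measurable k ∧ (∀ z, |k z| ≤ ‖ℓ‖) ∧
      ∀ (h : Z → ℝ) (hh : Integrable h P), ℓ (hh.toL1 h) = ∫ z, h z * k z ∂P := by
  have hint : ∀ h : Lp ℝ 2 P, Integrable h P := fun h => (Lp.memLp h).integrable one_le_two
  -- `L²` embeds in `L¹` for a probability measure, so the Riesz theorem represents the restriction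
  -- of `ℓ` to `L²`.
  let T₀ : Lp ℝ 2 P →ₗ[ℝ] ℝ :=
    { toFun := fun h => ℓ ((hint h).toL1 h)
      map_add' := fun a b => by
        rw [← map_add, ← Integrable.toL1_add]
        congr 1
        exact (Integrable.toL1_eq_toL1_iff _ _ _ _).2 (Lp.coeFn_add a b)
      map_smul' := fun c a => by
        rw [RingHom.id_apply, ← map_smul, ← Integrable.toL1_smul]
        congr 1
        exact (Integrable.toL1_eq_toL1_iff _ _ _ _).2 (Lp.coeFn_smul c a) }
  have hnorm : ∀ h : Lp ℝ 2 P, ‖(hint h).toL1 h‖ ≤ ‖h‖ := by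
    intro h
    rw [Integrable.toL1, Lp.norm_toLp, Lp.norm_def]
    exact ENNReal.toReal_mono (Lp.eLpNorm_ne_top h)
      (eLpNorm_le_eLpNorm_of_exponent_le one_le_two (Lp.aestronglyMeasurable h))
  let T : StrongDual ℝ (Lp ℝ 2 P) := T₀.mkContinuous ‖ℓ‖ fun h =>
    (ℓ.le_opNorm _).trans (mul_le_mul_of_nonneg_left (hnorm h) (norm_nonneg _))
  have hT : ∀ h : Lp ℝ 2 P, T h = ℓ ((hint h).toL1 h) := fun h => rfl
  set k₀ : Lp ℝ 2 P := (InnerProductSpace.toDual ℝ (Lp ℝ 2 P)).symm T with hk₀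
  have hinner : ∀ h : Lp ℝ 2 P, ℓ ((hint h).toL1 h) = ∫ z, h z * k₀ z ∂P := by
    intro h
    rw [← hT, ← InnerProductSpace.toDual_symm_apply (𝕜 := ℝ) (x := h) (y := T), L2.inner_def]
    rfl
  -- Testing on indicators bounds the averages of `k₀` over all sets, hence `k₀` itself a.e.
  have hset : ∀ A, MeasurableSet A → |∫ z in A, k₀ z ∂P| ≤ ∫ _ in A, ‖ℓ‖ ∂P := by
    intro A hA
    have hfin : P A ≠ ∞ := measure_ne_top P A
    rw [← L2.inner_indicatorConstLp_one (𝕜 := ℝ) hA hfin, real_inner_comm, hk₀,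
      InnerProductSpace.toDual_symm_apply, hT]
    refine (ℓ.le_opNorm _).trans ?_
    rw [L1.norm_of_fun_eq_integral_norm, setIntegral_const, smul_eq_mul, mul_comm]
    refine mul_le_mul_of_nonneg_right (le_of_eq ?_) (norm_nonneg _)
    have : ∫ z, ‖(indicatorConstLp 2 hA hfin (1 : ℝ) : Z → ℝ) z‖ ∂P =
        ∫ z, A.indicator (fun _ => (1 : ℝ)) z ∂P := by
      refine integral_congr_ae ?_
      filter_upwards [indicatorConstLp_coeFn (p := 2) (hs := hA) (hμs := hfin) (c := (1 : ℝ))]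
        with z hz
      rw [hz]
      by_cases hzA : z ∈ A <;> simp [hzA]
    rw [this, integral_indicator hA]
    simp
  have hle : ∀ᵐ z ∂P, |k₀ z| ≤ ‖ℓ‖ := by
    have h1 : (k₀ : Z → ℝ) ≤ᵐ[P] fun _ => ‖ℓ‖ :=
      ae_le_of_forall_setIntegral_le (hint k₀) (integrable_const _)
        fun A hA _ => (le_abs_self _).trans (hset A hA)
    have h2 : (fun z => -k₀ z) ≤ᵐ[P] fun _ => ‖ℓ‖ :=
      ae_le_of_forall_setIntegral_le (hint k₀).neg (integrable_const _)
        fun A hA _ => by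
          rw [integral_neg]
          exact (neg_le_abs _).trans (hset A hA)
    filter_upwards [h1, h2] with z hz1 hz2
    exact abs_le'.2 ⟨hz1, hz2⟩
  set k : Z → ℝ := fun z => max (-‖ℓ‖) (min ‖ℓ‖ (k₀ z)) with hk
  have hkm : Measurable k :=
    measurable_const.max (measurable_const.min (Lp.stronglyMeasurable k₀).measurable)
  have hkb : ∀ z, |k z| ≤ ‖ℓ‖ := fun z => by
    have := norm_nonneg ℓ
    rw [abs_le]
    exact ⟨le_max_left _ _, max_le (by linarith) (min_le_left _ _)⟩
  have hkk : k =ᵐ[P] k₀ := by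
    filter_upwards [hle] with z hz
    rw [abs_le] at hz
    simp only [hk]
    rw [min_eq_right hz.2, max_eq_right hz.1]
  refine ⟨k, hkm, hkb, fun h hh => ?_⟩
  have htm : ∀ n, AEStronglyMeasurable (fun z => trunc n (h z)) P := fun n =>
    ((measurable_trunc n).comp_aemeasurable hh.aemeasurable).aestronglyMeasurable
  have hn2 : ∀ n, MemLp (fun z => trunc n (h z)) 2 P := fun n =>
    MemLp.of_bound (htm n) n (ae_of_all _ fun z => abs_trunc_le n _)
  have hn : ∀ n, Integrable (fun z => trunc n (h z)) P := fun n =>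
    (hn2 n).integrable one_le_two
  have heq : ∀ n, ℓ ((hn n).toL1 _) = ∫ z, trunc n (h z) * k z ∂P := by
    intro n
    have h1 : (hn n).toL1 _ = (hint ((hn2 n).toLp _)).toL1 _ :=
      (Integrable.toL1_eq_toL1_iff _ _ _ _).2 (MemLp.coeFn_toLp _).symm
    rw [h1, hinner]
    refine integral_congr_ae ?_
    filter_upwards [hkk, MemLp.coeFn_toLp (hn2 n)] with z h1 h2
    rw [h1, h2]
  -- Truncations are in `L²` and converge in `L¹`, which extends the representation to every
  -- integrable `h`.
  have hL := (ℓ.continuous.tendsto _).comp (tendsto_toL1_trunc hh hn)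
  refine tendsto_nhds_unique (hL.congr heq) ?_
  refine tendsto_integral_of_dominated_convergence (fun z => |h z| * ‖ℓ‖)
    (fun n => (htm n).mul hkm.aestronglyMeasurable) (hh.abs.mul_const _)
    (fun n => ae_of_all _ fun z => ?_) (ae_of_all _ fun z => ?_)
  · rw [norm_mul]
    refine mul_le_mul ?_ (hkb z) (norm_nonneg _) (abs_nonneg _)
    have : (0 : ℝ) ≤ n := n.cast_nonneg
    simp only [trunc, Real.norm_eq_abs]
    grind
  · refine tendsto_const_nhds.congr' ?_
    filter_upwards [trunc_eventually_eq (h z)] with n h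
    rw [h]

theorem exists_dual_ne_zero_of_notMem_closure {E : Type*} [NormedAddCommGroup E]
    [NormedSpace ℝ E] (S : Submodule ℝ E) {x : E} (hx : x ∉ closure (S : Set E)) :
    ∃ ℓ : StrongDual ℝ E, (∀ y ∈ S, ℓ y = 0) ∧ ℓ x ≠ 0 := by
  obtain ⟨ℓ, u, hu, hux⟩ := geometric_hahn_banach_closed_point (s := closure (S : Set E))
    S.convex.closure isClosed_closure hx
  have h0 : 0 < u := by simpa using hu 0 (subset_closure S.zero_mem)
  refine ⟨ℓ, fun y hy => ?_, (h0.trans hux).ne'⟩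
  by_contra hne
  -- This multiple of `y` has value `u + 1`, above the bound `u`: a functional bounded above on a
  -- subspace vanishes there.
  have h1 := hu (((u + 1) / ℓ y) • y) (subset_closure (S.smul_mem _ hy))
  rw [map_smul, smul_eq_mul, div_mul_cancel₀ _ hne] at h1
  linarith

variable {X Y : Type*} [MeasurableSpace X] [MeasurableSpace Y]

/-- An integrable function that is orthogonal to all bounded functions with vanishing conditional
marginals is an a.e. limit of functions `f n (x) + g n (y)`. -/
theorem exists_seq_add_tendsto_of_orthogonal {P : Measure (X × Y)} [IsProbabilityMeasure P]
    {φ : X × Y → ℝ} (hφ : Integrable φ P)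
    (h : ∀ k : X × Y → ℝ, Measurable k → (∀ z, |k z| ≤ 1) →
      (∀ A, MeasurableSet A → ∫ z in Prod.fst ⁻¹' A, k z ∂P = 0) →
      (∀ B, MeasurableSet B → ∫ z in Prod.snd ⁻¹' B, k z ∂P = 0) → ∫ z, φ z * k z ∂P = 0) :
    ∃ (f : ℕ → X → ℝ) (g : ℕ → Y → ℝ), (∀ n, Measurable (f n)) ∧ (∀ n, Measurable (g n)) ∧
      ∀ᵐ z ∂P, Tendsto (fun n => f n z.1 + g n z.2) atTop (𝓝 (φ z)) := by
  let S : Submodule ℝ (Lp ℝ 1 P) :=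
    { carrier := {F | ∃ (f : X → ℝ) (g : Y → ℝ), Measurable f ∧ Measurable g ∧
        F =ᵐ[P] fun z => f z.1 + g z.2}
      zero_mem' := ⟨fun _ => 0, fun _ => 0, measurable_const, measurable_const, by
        filter_upwards [Lp.coeFn_zero ℝ 1 P] with z hz
        rw [hz]; simp⟩
      add_mem' := by
        rintro F G ⟨f, g, hf, hg, hF⟩ ⟨f', g', hf', hg', hG⟩
        refine ⟨f + f', g + g', hf.add hf', hg.add hg', ?_⟩
        filter_upwards [hF, hG, Lp.coeFn_add F G] with z h1 h2 h3
        rw [h3, Pi.add_apply, h1, h2, Pi.add_apply, Pi.add_apply]; ring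
      smul_mem' := by
        rintro c F ⟨f, g, hf, hg, hF⟩
        refine ⟨c • f, c • g, hf.const_smul c, hg.const_smul c, ?_⟩
        filter_upwards [hF, Lp.coeFn_smul c F] with z h1 h2
        rw [h2, Pi.smul_apply, h1, Pi.smul_apply, Pi.smul_apply, smul_add] }
  have hcl : hφ.toL1 φ ∈ closure (S : Set (Lp ℝ 1 P)) := by
    by_contra hcon
    obtain ⟨ℓ, hℓ, hne⟩ := exists_dual_ne_zero_of_notMem_closure S hcon
    obtain ⟨k, hkm, hkb, hk⟩ := exists_bounded_repr_of_dual_L1 ℓ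
    have hℓ0 : 0 < ‖ℓ‖ := norm_pos_iff.2 fun h0 => hne (by rw [h0]; rfl)
    -- Indicators of cylinders belong to `S`, so the kernel of `ℓ` has null marginals. Dividing by
    -- `‖ℓ‖` bounds it by one, and the hypothesis then contradicts `ℓ φ ≠ 0`.
    have hset : ∀ A : Set (X × Y), MeasurableSet A →
        (∀ hi : Integrable (A.indicator fun _ => (1 : ℝ)) P, hi.toL1 _ ∈ S) →
        ∫ z in A, k z / ‖ℓ‖ ∂P = 0 := by
      intro A hA hS
      have hi : Integrable (A.indicator fun _ => (1 : ℝ)) P := (integrable_const _).indicator hA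
      have h1 := hk _ hi
      rw [hℓ _ (hS hi)] at h1
      rw [integral_div, ← integral_indicator hA]
      have : (A.indicator fun z => k z) = fun z => A.indicator (fun _ => (1 : ℝ)) z * k z := by
        ext z; by_cases hz : z ∈ A <;> simp [hz]
      rw [this, ← h1, zero_div]
    have := h (fun z => k z / ‖ℓ‖) (hkm.div_const _)
      (fun z => by rw [abs_div, abs_norm]; exact (div_le_one hℓ0).2 (hkb z))
      (fun A hA => hset _ (measurable_fst hA) fun hi => ⟨A.indicator fun _ => 1, fun _ => 0,
        measurable_const.indicator hA, measurable_const, by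
          filter_upwards [hi.coeFn_toL1] with z hz
          rw [hz, add_zero]; rfl⟩)
      (fun B hB => hset _ (measurable_snd hB) fun hi => ⟨fun _ => 0, B.indicator fun _ => 1,
        measurable_const, measurable_const.indicator hB, by
          filter_upwards [hi.coeFn_toL1] with z hz
          rw [hz, zero_add]; rfl⟩)
    simp only [mul_div_assoc'] at this
    rw [integral_div, ← hk φ hφ, div_eq_zero_iff] at this
    exact this.elim hne hℓ0.ne'
  obtain ⟨F, hFS, hF⟩ := mem_closure_iff_seq_limit.1 hcl
  obtain ⟨ns, -, hns⟩ := (tendstoInMeasure_of_tendsto_Lp hF).exists_seq_tendsto_ae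
  choose f g hf hg hFfg using hFS
  refine ⟨fun n => f (ns n), fun n => g (ns n), fun n => hf _, fun n => hg _, ?_⟩
  filter_upwards [hns, hφ.coeFn_toL1, ae_all_iff.2 hFfg] with z h1 h2 h3
  rw [h2] at h1
  exact h1.congr fun n => h3 _

end LOneDuality

/-! ### Comparison of extended real energies -/

section Extended

/-- Reduces comparisons to real numbers once the left entropy is finite; an infinite right entropy
makes both sides true. -/
theorem coe_add_coe_ennreal_le_iff {a b : ℝ} {k l : ℝ≥0∞} (hk : k ≠ ∞) :
    (a : EReal) + (k : EReal) ≤ (b : EReal) + (l : EReal) ↔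
      (l ≠ ∞ → a + k.toReal ≤ b + l.toReal) := by
  rw [← EReal.coe_ennreal_toReal hk, ← EReal.coe_add]
  rcases eq_or_ne l ∞ with rfl | hl
  · simp
  · rw [← EReal.coe_ennreal_toReal hl, ← EReal.coe_add, EReal.coe_le_coe_iff]
    simp [hl]

theorem ne_top_of_coe_add_coe_ennreal_le {a b : ℝ} {k l : ℝ≥0∞} (hl : l ≠ ∞)
    (h : (a : EReal) + (k : EReal) ≤ (b : EReal) + (l : EReal)) : k ≠ ∞ := by
  rintro rfl
  rw [← EReal.coe_ennreal_toReal hl, ← EReal.coe_add, EReal.coe_ennreal_top,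
    EReal.coe_add_top] at h
  exact EReal.coe_ne_top _ (top_le_iff.1 h)

end Extended

/-! ### Sufficiency of the first-order system -/

section Inner

variable {Z : Type*} [MeasurableSpace Z]

theorem klDiv_ne_top_of_hasBoundedDensity {P R : ProbabilityMeasure Z}
    (h : HasBoundedDensity P R) : klDiv (P : Measure Z) (R : Measure Z) ≠ ∞ := by
  obtain ⟨hac, b₁, b₂, hb₁, hb, hae⟩ := h
  have hp := hasDensity_rnDeriv hac
  rw [hp.klDiv_ne_top_iff]
  refine Integrable.of_bound hp.measurable_klFun_comp.aestronglyMeasurable ((1 + b₂) ^ 2) ?_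
  filter_upwards [hae, Measure.rnDeriv_lt_top (P : Measure Z) (R : Measure Z)] with z hz hlt
  set p := ((P : Measure Z).rnDeriv (R : Measure Z) z).toReal with hpdef
  have h1 : b₁ ≤ p := (ENNReal.ofReal_le_iff_le_toReal hlt.ne).1 hz.1
  have h2 : p ≤ b₂ := ENNReal.toReal_le_of_le_ofReal (hb₁.le.trans hb) hz.2
  rw [Real.norm_of_nonneg (klFun_nonneg (hp.nonneg z))]
  have h3 := klFun_one_add_le (s := p - 1) (by linarith)
  rw [add_sub_cancel] at h3
  nlinarith

theorem klDiv_mix_ne_top_and_le {P Q R : ProbabilityMeasure Z}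
    (hP : klDiv (P : Measure Z) (R : Measure Z) ≠ ∞)
    (hQ : klDiv (Q : Measure Z) (R : Measure Z) ≠ ∞) (t : I) :
    klDiv (mix t P Q : Measure Z) (R : Measure Z) ≠ ∞ ∧
      (klDiv (mix t P Q : Measure Z) (R : Measure Z)).toReal ≤
        (1 - (t : ℝ)) * (klDiv (P : Measure Z) (R : Measure Z)).toReal +
          (t : ℝ) * (klDiv (Q : Measure Z) (R : Measure Z)).toReal := by
  have hp := hasDensity_rnDeriv (InformationTheory.klDiv_ne_top_iff.1 hP).1
  have hq := hasDensity_rnDeriv (InformationTheory.klDiv_ne_top_iff.1 hQ).1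
  have hi := ((hp.klDiv_ne_top_iff.1 hP).const_mul (1 - (t : ℝ))).add
    ((hq.klDiv_ne_top_iff.1 hQ).const_mul (t : ℝ))
  have hle := fun z => klFun_mix_le t.2.1 t.2.2 (hp.nonneg z) (hq.nonneg z)
  have hm := hp.mix hq t
  have him := hi.mono' hm.measurable_klFun_comp.aestronglyMeasurable (ae_of_all _ fun z => by
    rw [Real.norm_of_nonneg (klFun_nonneg (hm.nonneg z))]
    exact hle z)
  refine ⟨hm.klDiv_ne_top_iff.2 him, ?_⟩
  rw [hm.toReal_klDiv, hp.toReal_klDiv, hq.toReal_klDiv, ← integral_const_mul,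
    ← integral_const_mul, ← integral_add]
  · exact integral_mono him hi hle
  · exact (hp.klDiv_ne_top_iff.1 hP).const_mul _
  · exact (hq.klDiv_ne_top_iff.1 hQ).const_mul _

namespace HasDensity

variable {P R : Measure Z} {p : Z → ℝ}

theorem integrable_mul_log [IsFiniteMeasure P] [IsFiniteMeasure R] (h : HasDensity P R p)
    (hk : Integrable (fun z => klFun (p z)) R) : Integrable (fun z => p z * Real.log (p z)) R := by
  refine ((hk.add h.integrable).sub (integrable_const (1 : ℝ))).congr (ae_of_all _ fun z => ?_)
  simp only [Pi.sub_apply, Pi.add_apply, klFun_apply]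
  ring

theorem integrable_klFun_of_log [IsFiniteMeasure P] [IsFiniteMeasure R] (h : HasDensity P R p)
    (hk : Integrable (fun z => Real.log (p z)) P) : Integrable (fun z => klFun (p z)) R := by
  refine (((h.integrable_iff.1 hk).add (integrable_const (1 : ℝ))).sub h.integrable).congr
    (ae_of_all _ fun z => ?_)
  simp only [Pi.sub_apply, Pi.add_apply, klFun_apply]

theorem integrable_posLog [IsFiniteMeasure P] [IsFiniteMeasure R] {Q : Measure Z}
    [IsFiniteMeasure Q] {q : Z → ℝ} (h : HasDensity P R p) (hQ : HasDensity Q R q)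
    (hk : Integrable (fun z => klFun (q z)) R) : Integrable (fun z => Real.posLog (p z)) Q := by
  rw [hQ.integrable_iff]
  have hm : Measurable fun z => Real.posLog (p z) :=
    measurable_const.max (Real.measurable_log.comp h.measurable)
  refine (hk.add h.integrable).mono' (hQ.measurable.mul hm).aestronglyMeasurable
    (ae_of_all _ fun z => ?_)
  rw [Real.norm_of_nonneg (mul_nonneg (hQ.nonneg z) Real.posLog_nonneg)]
  exact mul_posLog_le (hQ.nonneg z) (h.nonneg z)

/-- Nonnegativity of `klFun` gives `-p log p ≤ 1 - p ≤ 1`, so no entropy bound is needed. -/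
theorem integrable_negLog [IsFiniteMeasure R] (h : HasDensity P R p) :
    Integrable (fun z => max 0 (-Real.log (p z))) P := by
  rw [h.integrable_iff]
  have hm : Measurable fun z => max 0 (-Real.log (p z)) :=
    measurable_const.max (Real.measurable_log.comp h.measurable).neg
  refine Integrable.of_bound (h.measurable.mul hm).aestronglyMeasurable 1 (ae_of_all _ fun z => ?_)
  rw [Real.norm_of_nonneg (mul_nonneg (h.nonneg z) (le_max_left _ _))]
  have h1 := klFun_nonneg (h.nonneg z)
  have h2 := h.nonneg z
  rw [klFun_apply] at h1
  rcases max_cases 0 (-Real.log (p z)) with ⟨h3, -⟩ | ⟨h3, -⟩ <;> rw [h3] <;> nlinarith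

end HasDensity

variable {X Y : Type*} [MeasurableSpace X] [MeasurableSpace Y] {μ : ProbabilityMeasure X}
  {ν : ProbabilityMeasure Y} {R : ProbabilityMeasure (X × Y)}
  {dF : ProbabilityMeasure (X × Y) → X × Y → ℝ} {π : ProbabilityMeasure (X × Y)} {C : ℝ}

/-- Comparison of a solution of the first-order system with a coupling of finite entropy. -/
theorem innerObjective_comparison_of_firstOrder (hm : Measurable (dF π))
    (hb : ∀ z, |dF π z| ≤ C) (hπ : π ∈ couplings μ ν) {f : X → ℝ} {g : Y → ℝ} {c : ℝ}
    (hf : Measurable f) (hg : Measurable g) (hfo : FirstOrder R dF π f g c)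
    {Q : ProbabilityMeasure (X × Y)} (hQ : Q ∈ couplings μ ν)
    (hQk : klDiv (Q : Measure (X × Y)) (R : Measure (X × Y)) ≠ ∞) :
    klDiv (π : Measure (X × Y)) (R : Measure (X × Y)) ≠ ∞ ∧
    (∫ z, dF π z ∂(π : Measure (X × Y)) +
        (klDiv (π : Measure (X × Y)) (R : Measure (X × Y))).toReal ≤
      ∫ z, dF π z ∂(Q : Measure (X × Y)) +
        (klDiv (Q : Measure (X × Y)) (R : Measure (X × Y))).toReal) ∧
    (∫ z, dF π z ∂(Q : Measure (X × Y)) +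
        (klDiv (Q : Measure (X × Y)) (R : Measure (X × Y))).toReal ≤
      ∫ z, dF π z ∂(π : Measure (X × Y)) +
        (klDiv (π : Measure (X × Y)) (R : Measure (X × Y))).toReal → Q = π) := by
  have hp := hasDensity_rnDeriv hfo.1
  have hq := hasDensity_rnDeriv (InformationTheory.klDiv_ne_top_iff.1 hQk).1
  have hfo2 := hfo.2
  set p : X × Y → ℝ := fun z => ((π : Measure (X × Y)).rnDeriv (R : Measure (X × Y)) z).toReal
  set q : X × Y → ℝ := fun z => ((Q : Measure (X × Y)).rnDeriv (R : Measure (X × Y)) z).toReal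
  have hkq := hq.klDiv_ne_top_iff.1 hQk
  have hfoR : ∀ᵐ z ∂(R : Measure (X × Y)), 0 < p z ∧
      Real.log (p z) = c - dF π z + (-f z.1 + -g z.2) := by
    filter_upwards [hfo2, Measure.rnDeriv_lt_top (π : Measure (X × Y)) (R : Measure (X × Y))]
      with z hz hlt
    exact ⟨ENNReal.toReal_pos hz.1.ne' hlt.ne, by linarith [hz.2]⟩
  have hfoP := hp.absolutelyContinuous.ae_le hfoR
  have hfoQ := hq.absolutelyContinuous.ae_le hfoR
  -- Up to bounded terms `-f - g` is `log p`. Its positive part is `Q`-integrable by Young's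
  -- inequality, and its negative part is `π`-integrable.
  have hpos : ∫⁻ z, ENNReal.ofReal (-f z.1 + -g z.2) ∂(Q : Measure (X × Y)) ≠ ∞ := by
    have hi := (hp.integrable_posLog hq hkq).add (integrable_const (C + |c|))
    refine ne_top_of_le_ne_top hi.lintegral_lt_top.ne (lintegral_mono_ae ?_)
    filter_upwards [hfoQ] with z hz
    refine ENNReal.ofReal_le_ofReal ?_
    have h1 : Real.log (p z) ≤ Real.posLog (p z) := le_max_right _ _
    have h2 := (abs_le.1 (hb z)).2
    have h3 := neg_abs_le c
    simp only [Pi.add_apply]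
    linarith [hz.2]
  have hneg : ∫⁻ z, ENNReal.ofReal (-(-f z.1 + -g z.2)) ∂(π : Measure (X × Y)) ≠ ∞ := by
    have hi := hp.integrable_negLog.add (integrable_const (C + |c|))
    refine ne_top_of_le_ne_top hi.lintegral_lt_top.ne (lintegral_mono_ae ?_)
    filter_upwards [hfoP] with z hz
    refine ENNReal.ofReal_le_ofReal ?_
    have h1 : -Real.log (p z) ≤ max 0 (-Real.log (p z)) := le_max_right _ _
    have h2 := (abs_le.1 (hb z)).1
    have h3 := le_abs_self c
    simp only [Pi.add_apply]
    linarith [hz.2]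
  obtain ⟨iP, iQ, hPQ⟩ :=
    integral_add_eq_of_integrable_parts hπ hQ hf.neg hg.neg hpos hneg
  simp only [Pi.neg_apply] at iP iQ hPQ
  have hDi : ∀ P : ProbabilityMeasure (X × Y), Integrable (dF π) (P : Measure (X × Y)) := fun P =>
    Integrable.of_bound hm.aestronglyMeasurable C (ae_of_all _ hb)
  have key : ∀ P : ProbabilityMeasure (X × Y), (P : Measure (X × Y)) ≪ (R : Measure (X × Y)) →
      Integrable (fun z => -f z.1 + -g z.2) (P : Measure (X × Y)) →
      Integrable (fun z => Real.log (p z)) (P : Measure (X × Y)) ∧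
      ∫ z, Real.log (p z) ∂(P : Measure (X × Y)) = c - ∫ z, dF π z ∂(P : Measure (X × Y)) +
        ∫ z, -f z.1 + -g z.2 ∂(P : Measure (X × Y)) := by
    intro P hac hi
    have hae : (fun z => Real.log (p z)) =ᵐ[(P : Measure (X × Y))]
        fun z => (c - dF π z) + (-f z.1 + -g z.2) := by
      filter_upwards [hac.ae_le hfoR] with z hz using hz.2
    have hci : Integrable (fun z => c - dF π z) (P : Measure (X × Y)) :=
      (integrable_const c).sub (hDi P)
    refine ⟨(hci.add hi).congr hae.symm, ?_⟩
    rw [integral_congr_ae hae, integral_add hci hi, integral_sub (integrable_const c) (hDi P)]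
    simp
  obtain ⟨lP, eP⟩ := key π hp.absolutelyContinuous iP
  obtain ⟨lQ, eQ⟩ := key Q hq.absolutelyContinuous iQ
  have hkp := hp.integrable_klFun_of_log lP
  -- The integrand of `H(Q ‖ π)` in Bregman form, equal to `p * klFun (q / p)`; its integral is the
  -- difference of the two objectives.
  set e : X × Y → ℝ := fun z =>
    klFun (q z) - klFun (p z) - (q z * Real.log (p z) - p z * Real.log (p z)) with he
  have hlQ := hq.integrable_iff.1 lQ
  have hlP := hp.integrable_iff.1 lP
  have hei : Integrable e (R : Measure (X × Y)) := (hkq.sub hkp).sub (hlQ.sub hlP)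
  have heq : ∀ᵐ z ∂(R : Measure (X × Y)), e z = p z * klFun (q z / p z) := by
    filter_upwards [hfoR] with z hz
    rw [mul_klFun_div hz.1 (hq.nonneg z)]
    simp only [he]; ring
  have he0 : 0 ≤ᵐ[(R : Measure (X × Y))] e := by
    filter_upwards [heq] with z hz
    rw [hz]
    exact mul_nonneg (hp.nonneg z) (klFun_nonneg (div_nonneg (hq.nonneg z) (hp.nonneg z)))
  have hint : ∫ z, e z ∂(R : Measure (X × Y)) =
      (∫ z, dF π z ∂(Q : Measure (X × Y)) +
        (klDiv (Q : Measure (X × Y)) (R : Measure (X × Y))).toReal) -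
      (∫ z, dF π z ∂(π : Measure (X × Y)) +
        (klDiv (π : Measure (X × Y)) (R : Measure (X × Y))).toReal) := by
    have hstep : ∫ z, e z ∂(R : Measure (X × Y)) =
        (∫ z, klFun (q z) ∂(R : Measure (X × Y)) - ∫ z, klFun (p z) ∂(R : Measure (X × Y))) -
        (∫ z, q z * Real.log (p z) ∂(R : Measure (X × Y)) -
          ∫ z, p z * Real.log (p z) ∂(R : Measure (X × Y))) := by
      rw [← integral_sub hkq hkp, ← integral_sub hlQ hlP]
      exact integral_sub (hkq.sub hkp) (hlQ.sub hlP)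
    rw [hstep, ← hq.integral_eq, ← hp.integral_eq, hp.toReal_klDiv, hq.toReal_klDiv, eP, eQ, hPQ]
    ring
  refine ⟨hp.klDiv_ne_top_iff.2 hkp, ?_, fun hle => ?_⟩
  · have := integral_nonneg_of_ae he0
    linarith
  · have hz : ∫ z, e z ∂(R : Measure (X × Y)) = 0 :=
      le_antisymm (by linarith) (integral_nonneg_of_ae he0)
    have hz' := (integral_eq_zero_iff_of_nonneg_ae he0 hei).1 hz
    apply Subtype.ext
    refine hq.eq_of_ae_eq hp ?_
    filter_upwards [hz', heq, hfoR] with z h1 h2 h3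
    rw [h1, Pi.zero_apply, eq_comm, mul_eq_zero] at h2
    have h4 := h2.resolve_left h3.1.ne'
    rw [klFun_eq_zero_iff (div_nonneg (hq.nonneg z) (hp.nonneg z)), div_eq_one_iff_eq h3.1.ne']
      at h4
    exact h4

theorem bestResponse_eq_singleton_of_firstOrder (hm : Measurable (dF π))
    (hb : ∀ z, |dF π z| ≤ C) (hπ : π ∈ couplings μ ν) {f : X → ℝ} {g : Y → ℝ} {c : ℝ}
    (hf : Measurable f) (hg : Measurable g) (hfo : FirstOrder R dF π f g c)
    {P₀ : ProbabilityMeasure (X × Y)} (hP₀ : P₀ ∈ couplings μ ν)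
    (hP₀k : klDiv (P₀ : Measure (X × Y)) (R : Measure (X × Y)) ≠ ∞) :
    bestResponse μ ν R dF π = {π} := by
  have key := fun (Q : ProbabilityMeasure (X × Y)) (hQ : Q ∈ couplings μ ν) hQk =>
    innerObjective_comparison_of_firstOrder hm hb hπ hf hg hfo hQ hQk
  have hk := (key P₀ hP₀ hP₀k).1
  refine Subset.antisymm ?_ (singleton_subset_iff.2 ⟨hπ, fun ρ hρ => ?_⟩)
  · rintro ρ ⟨hρ, hmin⟩
    have h1 := hmin π hπ
    unfold innerObjective at h1
    have hρk := ne_top_of_coe_add_coe_ennreal_le hk h1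
    exact (key ρ hρ hρk).2.2 ((coe_add_coe_ennreal_le_iff hρk).1 h1 hk)
  · unfold innerObjective
    exact (coe_add_coe_ennreal_le_iff hk).2 fun hρk => (key ρ hρ hρk).2.1

end Inner

/-! ### Necessity of the first-order system -/

section Necessary

variable {X Y : Type*} [MeasurableSpace X] [MeasurableSpace Y] {μ : ProbabilityMeasure X}
  {ν : ProbabilityMeasure Y} {R : ProbabilityMeasure (X × Y)}
  {dF : ProbabilityMeasure (X × Y) → X × Y → ℝ} {P π : ProbabilityMeasure (X × Y)} {C : ℝ}

theorem nonpos_of_add_log_mul_nonneg {A B : ℝ}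
    (h : ∀ t : ℝ, 0 < t → t ≤ 1 → 0 ≤ A + Real.log t * B) : B ≤ 0 := by
  by_contra! hB
  have h1 : 0 < (|A| + 1) / B := by positivity
  have h2 := h (Real.exp (-((|A| + 1) / B))) (Real.exp_pos _) (Real.exp_le_one_iff.2 (by linarith))
  rw [Real.log_exp, neg_mul, div_mul_cancel₀ _ hB.ne'] at h2
  linarith [le_abs_self A]

/-- A minimizer of the inner objective has positive density as soon as some coupling of finite
entropy has. -/
theorem ae_pos_of_mem_bestResponse (hm : Measurable (dF P)) (hb : ∀ z, |dF P z| ≤ C)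
    (hπ : π ∈ bestResponse μ ν R dF P) {p : X × Y → ℝ}
    (hp : HasDensity (π : Measure (X × Y)) (R : Measure (X × Y)) p)
    {Q : ProbabilityMeasure (X × Y)} (hQ : Q ∈ couplings μ ν) {q : X × Y → ℝ}
    (hq : HasDensity (Q : Measure (X × Y)) (R : Measure (X × Y)) q)
    (hQk : klDiv (Q : Measure (X × Y)) (R : Measure (X × Y)) ≠ ∞)
    (hpos : ∀ᵐ z ∂(R : Measure (X × Y)), 0 < q z) : ∀ᵐ z ∂(R : Measure (X × Y)), 0 < p z := by
  have hle := fun ρ hρ => hπ.2 ρ hρ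
  unfold innerObjective at hle
  have hk := ne_top_of_coe_add_coe_ennreal_le hQk (hle Q hQ)
  have hkp := hp.klDiv_ne_top_iff.1 hk
  have hkq := hq.klDiv_ne_top_iff.1 hQk
  have hD : ∀ P' : ProbabilityMeasure (X × Y), Integrable (dF P) (P' : Measure (X × Y)) :=
    fun P' => Integrable.of_bound hm.aestronglyMeasurable C (ae_of_all _ hb)
  set N : Set (X × Y) := {z | p z = 0} with hN
  have hNm : MeasurableSet N := hp.measurable (measurableSet_singleton 0)
  set B : ℝ := ∫ z in N, q z ∂(R : Measure (X × Y)) with hB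
  have hqi := hq.integrable
  have hB0 : B ≤ 0 := by
    -- Moving from `π` towards `Q` by `t` costs at most `t A` by convexity, and gains `t log t`
    -- times the `Q`-mass of `{p = 0}`. As `log t → -∞`, minimality forces this mass to be zero.
    refine nonpos_of_add_log_mul_nonneg (A := (∫ z, dF P z ∂(Q : Measure (X × Y)) -
      ∫ z, dF P z ∂(π : Measure (X × Y))) + (∫ z, klFun (q z) ∂(R : Measure (X × Y)) -
      ∫ z, klFun (p z) ∂(R : Measure (X × Y)))) fun t ht0 ht1 => ?_
    set t' : I := ⟨t, ht0.le, ht1⟩ with ht'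
    have hmix := hp.mix hq t'
    obtain ⟨hkm, -⟩ := klDiv_mix_ne_top_and_le hk hQk t'
    have h1 := (coe_add_coe_ennreal_le_iff hk).1
      (hle _ (mix_mem_couplings hπ.1 hQ t')) hkm
    rw [hp.toReal_klDiv, hmix.toReal_klDiv, integral_mix _ _ _ (hD _) (hD _)] at h1
    have hi1 := (hkp.const_mul (1 - t)).add (hkq.const_mul t)
    have hi2 := (hqi.indicator hNm).const_mul (t * Real.log t)
    have h2 : ∫ z, klFun ((1 - t) * p z + t * q z) ∂(R : Measure (X × Y)) ≤
        ((1 - t) * ∫ z, klFun (p z) ∂(R : Measure (X × Y)) +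
          t * ∫ z, klFun (q z) ∂(R : Measure (X × Y))) + t * Real.log t * B := by
      rw [hB, ← integral_indicator hNm, ← integral_const_mul, ← integral_const_mul,
        ← integral_const_mul, ← integral_add (hkp.const_mul _) (hkq.const_mul _)]
      refine (integral_mono (hmix.klDiv_ne_top_iff.1 hkm) (hi1.add hi2) fun z => ?_).trans_eq
        (integral_add hi1 hi2)
      change klFun ((1 - t) * p z + t * q z) ≤
        ((1 - t) * klFun (p z) + t * klFun (q z)) + t * Real.log t * N.indicator q z
      by_cases hz : z ∈ N
      · rw [indicator_of_mem hz, show p z = 0 from hz]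
        exact (klFun_mix_le_of_eq_zero ht0 (hq.nonneg z)).le
      · rw [indicator_of_notMem hz, mul_zero, add_zero]
        exact klFun_mix_le ht0.le ht1 (hp.nonneg z) (hq.nonneg z)
    have h3 := h1.trans (add_le_add_right h2 _)
    simp only [ht'] at h3
    refine nonneg_of_mul_nonneg_right (a := t) ?_ ht0
    linarith
  have hB1 : B = 0 := le_antisymm hB0 (integral_nonneg fun z => hq.nonneg z)
  have h0 := (integral_eq_zero_iff_of_nonneg (fun z => hq.nonneg z) hqi.integrableOn).1 hB1
  rw [Filter.EventuallyEq, ae_restrict_iff' hNm] at h0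
  filter_upwards [h0, hpos] with z h1 h2
  refine lt_of_le_of_ne (hp.nonneg z) fun h3 => h2.ne' (h1 h3.symm)

/-- At a minimizer `π` of the inner objective, the derivative in the direction of `k π` vanishes
for all bounded `k` such that `k π` has null marginals. -/
theorem integral_add_log_mul_eq_zero (hm : Measurable (dF P)) (hb : ∀ z, |dF P z| ≤ C)
    (hπ : π ∈ bestResponse μ ν R dF P) {p : X × Y → ℝ}
    (hp : HasDensity (π : Measure (X × Y)) (R : Measure (X × Y)) p)
    (hk : klDiv (π : Measure (X × Y)) (R : Measure (X × Y)) ≠ ∞)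
    {k : X × Y → ℝ} (hkm : Measurable k) (hkb : ∀ z, |k z| ≤ 1)
    (h1 : ∀ A, MeasurableSet A → ∫ z in Prod.fst ⁻¹' A, k z ∂(π : Measure (X × Y)) = 0)
    (h2 : ∀ B, MeasurableSet B → ∫ z in Prod.snd ⁻¹' B, k z ∂(π : Measure (X × Y)) = 0) :
    ∫ z, (dF P z + Real.log (p z)) * k z ∂(π : Measure (X × Y)) = 0 := by
  have hkp := hp.klDiv_ne_top_iff.1 hk
  have hD : ∀ P' : ProbabilityMeasure (X × Y), Integrable (dF P) (P' : Measure (X × Y)) :=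
    fun P' => Integrable.of_bound hm.aestronglyMeasurable C (ae_of_all _ hb)
  have hlog : Integrable (fun z => Real.log (p z)) (π : Measure (X × Y)) :=
    hp.integrable_iff.2 (hp.integrable_mul_log hkp)
  -- The admissible directions are symmetric under `k ↦ -k`, so one inequality suffices.
  suffices key : ∀ k : X × Y → ℝ, Measurable k → (∀ z, |k z| ≤ 1) →
      (∀ A, MeasurableSet A → ∫ z in Prod.fst ⁻¹' A, k z ∂(π : Measure (X × Y)) = 0) →
      (∀ B, MeasurableSet B → ∫ z in Prod.snd ⁻¹' B, k z ∂(π : Measure (X × Y)) = 0) →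
      0 ≤ ∫ z, (dF P z + Real.log (p z)) * k z ∂(π : Measure (X × Y)) by
    refine le_antisymm ?_ (key k hkm hkb h1 h2)
    have := key (fun z => -k z) hkm.neg (fun z => by rw [abs_neg]; exact hkb z)
      (fun A hA => by rw [integral_neg, h1 A hA, neg_zero])
      (fun B hB => by rw [integral_neg, h2 B hB, neg_zero])
    simp only [mul_neg, integral_neg] at this
    linarith
  clear h1 h2 hkb hkm k
  intro k hkm hkb h1 h2
  have hkb' : ∀ᵐ z ∂(π : Measure (X × Y)), ‖k z‖ ≤ 1 := ae_of_all _ hkb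
  have hki : Integrable k (π : Measure (X × Y)) :=
    Integrable.of_bound hkm.aestronglyMeasurable 1 hkb'
  have hDk : Integrable (fun z => dF P z * k z) (π : Measure (X × Y)) :=
    (hD π).mul_bdd (c := 1) hkm.aestronglyMeasurable hkb'
  have hlk : Integrable (fun z => Real.log (p z) * k z) (π : Measure (X × Y)) :=
    hlog.mul_bdd (c := 1) hkm.aestronglyMeasurable hkb'
  refine le_of_forall_pos_le_add fun ε' hε' => ?_
  -- The cap `1 / 2` keeps `1 + ε k` positive. The objective changes by `ε` times the derivative
  -- plus at most `ε ^ 2`, so dividing by `ε` leaves an error below `ε'`.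
  set ε : ℝ := min ε' (1 / 2) with hε
  have hε0 : 0 < ε := lt_min hε' (by norm_num)
  have hε1 : ε ≤ 1 / 2 := min_le_right _ _
  have hs : ∀ z, |ε * k z| ≤ 1 / 2 := fun z => by
    rw [abs_mul, abs_of_pos hε0]
    nlinarith [hkb z, abs_nonneg (k z)]
  have hs1 : ∀ z, -1 < ε * k z := fun z => by linarith [(abs_le.1 (hs z)).1]
  set q : X × Y → ℝ := fun z => p z * (1 + ε * k z) with hqdef
  have hpi := hp.integrable
  have hpk : Integrable (fun z => p z * k z) (R : Measure (X × Y)) := hp.integrable_iff.1 hki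
  have hq_eq : q = fun z => p z + ε * (p z * k z) := by ext z; simp only [hqdef]; ring
  have hqi : Integrable q (R : Measure (X × Y)) := by
    rw [hq_eq]; exact hpi.add (hpk.const_mul ε)
  have hset : ∀ A, MeasurableSet A → ∫ z in A, k z ∂(π : Measure (X × Y)) = 0 →
      ∫ z in A, q z ∂(R : Measure (X × Y)) = ∫ z in A, p z ∂(R : Measure (X × Y)) := by
    intro A hA h0
    rw [hq_eq, integral_add hpi.integrableOn (hpk.const_mul ε).integrableOn, integral_const_mul]
    have : ∫ z in A, p z * k z ∂(R : Measure (X × Y)) = 0 := by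
      rw [← integral_indicator hA, ← h0, ← integral_indicator hA, hp.integral_eq]
      congr 1 with z
      by_cases hz : z ∈ A <;> simp [hz]
    rw [this]; simp
  have hq1 : ∫ z, q z ∂(R : Measure (X × Y)) = 1 := by
    have := hset univ MeasurableSet.univ (h1 univ MeasurableSet.univ)
    rwa [setIntegral_univ, setIntegral_univ, hp.integral_eq_one] at this
  obtain ⟨Q, hQ⟩ := exists_probabilityMeasure_hasDensity (q := q)
    (hp.measurable.mul (measurable_const.add (hkm.const_mul ε)))
    (fun z => mul_nonneg (hp.nonneg z) (by linarith [hs1 z])) hqi hq1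
  have hQc : Q ∈ couplings μ ν := mem_couplings_of_measureReal_eq hπ.1
    (fun A hA => by
      rw [hQ.measureReal_eq (measurable_fst hA), hp.measureReal_eq (measurable_fst hA)]
      exact hset _ (measurable_fst hA) (h1 A hA))
    (fun B hB => by
      rw [hQ.measureReal_eq (measurable_snd hB), hp.measureReal_eq (measurable_snd hB)]
      exact hset _ (measurable_snd hB) (h2 B hB))
  have hkl : ∀ z, klFun (q z) =
      klFun (p z) + ε * (p z * (Real.log (p z) * k z)) + p z * klFun (1 + ε * k z) := fun z => by
    simp only [hqdef]
    rw [klFun_mul_one_add (hs1 z)]; ring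
  have hlast : ∀ z, ‖klFun (1 + ε * k z)‖ ≤ ε ^ 2 := fun z => by
    rw [Real.norm_of_nonneg (klFun_nonneg (by linarith [hs1 z]))]
    refine (klFun_one_add_le (hs1 z)).trans ?_
    rw [mul_pow]
    have : k z ^ 2 ≤ 1 := (sq_le_one_iff_abs_le_one _).2 (hkb z)
    nlinarith [sq_nonneg ε]
  have hlm : Measurable fun z => klFun (1 + ε * k z) :=
    measurable_klFun.comp (measurable_const.add (hkm.const_mul ε))
  have hlasti : Integrable (fun z => klFun (1 + ε * k z)) (π : Measure (X × Y)) :=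
    Integrable.of_bound hlm.aestronglyMeasurable _ (ae_of_all _ hlast)
  have hi1 := (hp.integrable_iff.1 hlk).const_mul ε
  have hi2 := hp.integrable_iff.1 hlasti
  have hkq : Integrable (fun z => klFun (q z)) (R : Measure (X × Y)) := by
    simp only [hkl]
    exact (hkp.add hi1).add hi2
  have hQk := hQ.klDiv_ne_top_iff.2 hkq
  have hle := hπ.2 Q hQc
  unfold innerObjective at hle
  have hle' := (coe_add_coe_ennreal_le_iff hk).1 hle hQk
  have hQint : ∫ z, klFun (q z) ∂(R : Measure (X × Y)) ≤ ∫ z, klFun (p z) ∂(R : Measure (X × Y)) +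
      ε * ∫ z, Real.log (p z) * k z ∂(π : Measure (X × Y)) + ε ^ 2 := by
    have e1 : ∫ z, klFun (q z) ∂(R : Measure (X × Y)) =
        ∫ z, klFun (p z) ∂(R : Measure (X × Y)) +
        ∫ z, ε * (p z * (Real.log (p z) * k z)) ∂(R : Measure (X × Y)) +
        ∫ z, p z * klFun (1 + ε * k z) ∂(R : Measure (X × Y)) := by
      simp only [hkl]
      rw [← integral_add hkp hi1]
      exact integral_add (hkp.add hi1) hi2
    rw [e1, integral_const_mul, ← hp.integral_eq, ← hp.integral_eq]
    refine add_le_add_right ?_ _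
    refine (le_abs_self _).trans ((norm_integral_le_of_norm_le_const
      (ae_of_all _ hlast)).trans ?_)
    simp
  have hDint : ∫ z, dF P z ∂(Q : Measure (X × Y)) = ∫ z, dF P z ∂(π : Measure (X × Y)) +
      ε * ∫ z, dF P z * k z ∂(π : Measure (X × Y)) := by
    rw [hQ.integral_eq, hp.integral_eq, hp.integral_eq, ← integral_const_mul, ← integral_add
      (hp.integrable_iff.1 (hD π)) ((hp.integrable_iff.1 hDk).const_mul ε)]
    congr 1 with z
    simp only [hqdef]; ring
  rw [hQ.toReal_klDiv, hp.toReal_klDiv, hDint] at hle'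
  have hsum : ∫ z, (dF P z + Real.log (p z)) * k z ∂(π : Measure (X × Y)) =
      ∫ z, dF P z * k z ∂(π : Measure (X × Y)) +
        ∫ z, Real.log (p z) * k z ∂(π : Measure (X × Y)) := by
    simp only [add_mul]
    exact integral_add hDk hlk
  rw [hsum]
  have hfin : 0 ≤ ε * (∫ z, dF P z * k z ∂(π : Measure (X × Y)) +
        ∫ z, Real.log (p z) * k z ∂(π : Measure (X × Y)) + ε) := by nlinarith
  have := nonneg_of_mul_nonneg_right hfin hε0
  linarith [min_le_left ε' (1 / 2)]

/-- Stationarity makes `dF π + log p` a limit of sums, hence a sum, `π`-a.e. Positivity of `p` gives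
`R ≪ π`, which turns this into an `R`-a.e. statement; the constant is absorbed in the potentials. -/
theorem exists_firstOrder_of_mem_bestResponse
    (hR : (R : Measure (X × Y)) ≪ (μ : Measure X).prod (ν : Measure Y))
    (hm : Measurable (dF π)) (hb : ∀ z, |dF π z| ≤ C) (hπ : π ∈ bestResponse μ ν R dF π)
    {P₀ : ProbabilityMeasure (X × Y)} (hP₀ : P₀ ∈ couplings μ ν)
    (hP₀b : HasBoundedDensity P₀ R) :
    ∃ (f : X → ℝ) (g : Y → ℝ) (c : ℝ), Measurable f ∧ Measurable g ∧ FirstOrder R dF π f g c := by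
  have hP₀k := klDiv_ne_top_of_hasBoundedDensity hP₀b
  have hle := hπ.2 P₀ hP₀
  unfold innerObjective at hle
  have hk := ne_top_of_coe_add_coe_ennreal_le hP₀k hle
  have hac := (InformationTheory.klDiv_ne_top_iff.1 hk).1
  have hp := hasDensity_rnDeriv hac
  set p : X × Y → ℝ := fun z => ((π : Measure (X × Y)).rnDeriv (R : Measure (X × Y)) z).toReal
  have hpos : ∀ᵐ z ∂(R : Measure (X × Y)), 0 < p z := by
    refine ae_pos_of_mem_bestResponse hm hb hπ hp hP₀ (hasDensity_rnDeriv hP₀b.1) hP₀k ?_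
    obtain ⟨-, b₁, b₂, hb₁, -, hae⟩ := hP₀b
    filter_upwards [hae, Measure.rnDeriv_lt_top (P₀ : Measure (X × Y)) (R : Measure (X × Y))]
      with z hz hlt
    exact hb₁.trans_le ((ENNReal.ofReal_le_iff_le_toReal hlt.ne).1 hz.1)
  have hφ : Integrable (fun z => dF π z + Real.log (p z)) (π : Measure (X × Y)) :=
    (Integrable.of_bound hm.aestronglyMeasurable C (ae_of_all _ hb)).add
      (hp.integrable_iff.2 (hp.integrable_mul_log (hp.klDiv_ne_top_iff.1 hk)))
  obtain ⟨f, g, hf, hg, hfg⟩ := exists_seq_add_tendsto_of_orthogonal hφ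
    fun k hkm hkb h1 h2 => integral_add_log_mul_eq_zero hm hb hπ hp hk hkm hkb h1 h2
  have : Nonempty X := μ.nonempty
  obtain ⟨f', g', hf', hg', hfg'⟩ := exists_add_of_ae_tendsto (hac.trans hR) hf hg hfg
  refine ⟨fun x => -f' x, fun y => -g' y, 0, hf'.neg, hg'.neg, hac, ?_⟩
  filter_upwards [hpos, (hp.absolutelyContinuous_of_pos hpos).ae_le hfg'] with z h1 h2
  refine ⟨(ENNReal.toReal_pos_iff.1 h1).1, ?_⟩
  change dF π z + Real.log (p z) + _ + _ = _
  rw [h2]; ring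

end Necessary

/-! ### Calculus with the linear derivative -/

section LinearDerivative

theorem exists_abs_le_of_osc {Z : Type*} [Nonempty Z] {h : Z → ℝ} {C : ℝ}
    (hosc : ∀ z z', h z - h z' ≤ C) : ∃ K, ∀ z, |h z| ≤ K := by
  obtain ⟨z₀⟩ := ‹Nonempty Z›
  refine ⟨|h z₀| + C, fun z => abs_le.2 ⟨?_, ?_⟩⟩
  · linarith [hosc z₀ z, neg_abs_le (h z₀)]
  · linarith [hosc z z₀, le_abs_self (h z₀)]

variable {Z : Type*} [TopologicalSpace Z] [MeasurableSpace Z] [OpensMeasurableSpace Z]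
  {F : ProbabilityMeasure Z → ℝ} {dF : ProbabilityMeasure Z → Z → ℝ} {C : ℝ}

theorem continuous_mix (P Q : ProbabilityMeasure Z) : Continuous fun t : I => mix t P Q := by
  refine continuous_iff_continuousAt.2 fun t => ?_
  refine ProbabilityMeasure.tendsto_iff_forall_integral_tendsto.2 fun f => ?_
  have h : ∀ s : I, ∫ z, f z ∂(mix s P Q : Measure Z) =
      (1 - (s : ℝ)) * ∫ z, f z ∂(P : Measure Z) + (s : ℝ) * ∫ z, f z ∂(Q : Measure Z) := fun s =>
    integral_mix s P Q (f.integrable _) (f.integrable _)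
  simp only [h]
  exact Continuous.tendsto (by fun_prop) t

namespace HasLinearDerivative

theorem measurable (hd : HasLinearDerivative F dF) (π : ProbabilityMeasure Z) :
    Measurable (dF π) :=
  (hd.continuous.comp (continuous_const.prodMk continuous_id)).measurable

theorem integrable (hd : HasLinearDerivative F dF) (hosc : ∀ π z z', dF π z - dF π z' ≤ C)
    (π ρ : ProbabilityMeasure Z) : Integrable (dF π) (ρ : Measure Z) := by
  have := ρ.nonempty
  obtain ⟨K, hK⟩ := exists_abs_le_of_osc (hosc π)
  exact Integrable.of_bound (hd.measurable π).aestronglyMeasurable K (ae_of_all _ hK)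

/-- Constants cancel between two probability measures. After centring at `z₀`, the derivative is
bounded by `C` uniformly in `m`, whereas only its oscillation was controlled before. -/
theorem integral_sub_eq (hd : HasLinearDerivative F dF)
    (hosc : ∀ π z z', dF π z - dF π z' ≤ C) (m π ρ : ProbabilityMeasure Z) (z₀ : Z) :
    ∫ z, dF m z ∂(ρ : Measure Z) - ∫ z, dF m z ∂(π : Measure Z) =
      ∫ z, dF m z - dF m z₀ ∂(ρ : Measure Z) - ∫ z, dF m z - dF m z₀ ∂(π : Measure Z) := by
  rw [integral_sub (hd.integrable hosc m ρ) (integrable_const _),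
    integral_sub (hd.integrable hosc m π) (integrable_const _)]
  simp

theorem continuous_integral_sub (hd : HasLinearDerivative F dF)
    (hosc : ∀ π z z', dF π z - dF π z' ≤ C) (π ρ : ProbabilityMeasure Z) :
    Continuous fun t : I => ∫ z, dF (mix t π ρ) z ∂(ρ : Measure Z) -
      ∫ z, dF (mix t π ρ) z ∂(π : Measure Z) := by
  obtain ⟨z₀⟩ := π.nonempty
  simp only [fun t : I => hd.integral_sub_eq hosc (mix t π ρ) π ρ z₀]
  have key : ∀ P : ProbabilityMeasure Z, Continuous fun t : I =>
      ∫ z, dF (mix t π ρ) z - dF (mix t π ρ) z₀ ∂(P : Measure Z) := by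
    intro P
    refine continuous_of_dominated (bound := fun _ => C)
      (fun t => ((hd.measurable _).sub_const _).aestronglyMeasurable)
      (fun t => ae_of_all _ fun z => ?_) (integrable_const _) (ae_of_all _ fun z => ?_)
    · exact abs_sub_le_iff.2 ⟨hosc _ _ _, hosc _ _ _⟩
    · exact (hd.continuous.comp ((continuous_mix π ρ).prodMk continuous_const)).sub
        (hd.continuous.comp ((continuous_mix π ρ).prodMk continuous_const))
  exact (key ρ).sub (key π)

/-- Mixtures along a segment compose by multiplying parameters, and integration against `mix t π ρ`
is affine in `t`, so a factor `t` comes out. -/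
theorem mix_sub_eq (hd : HasLinearDerivative F dF) (hosc : ∀ π z z', dF π z - dF π z' ≤ C)
    (π ρ : ProbabilityMeasure Z) (t : I) :
    F (mix t π ρ) - F π = t * ∫ η : I, (∫ z, dF (mix (η * t) π ρ) z ∂(ρ : Measure Z) -
      ∫ z, dF (mix (η * t) π ρ) z ∂(π : Measure Z)) := by
  rw [hd.sub_eq, ← integral_const_mul]
  congr 1 with η
  rw [mix_mix, integral_mix t π ρ (hd.integrable hosc _ _) (hd.integrable hosc _ _)]
  ring

/-- The one-sided directional derivative of `F` along segments. -/
theorem tendsto_slope (hd : HasLinearDerivative F dF) (hosc : ∀ π z z', dF π z - dF π z' ≤ C)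
    (π ρ : ProbabilityMeasure Z) :
    ∃ t : ℕ → I, (∀ n, 0 < (t n : ℝ)) ∧
      Tendsto (fun n => (F (mix (t n) π ρ) - F π) / t n) atTop
        (𝓝 (∫ z, dF π z ∂(ρ : Measure Z) - ∫ z, dF π z ∂(π : Measure Z))) := by
  set t : ℕ → I := fun n => ⟨1 / ((n : ℝ) + 1), by positivity,
    (div_le_one (by positivity)).2 (by linarith [n.cast_nonneg (α := ℝ)])⟩ with ht
  have ht0 : ∀ n, 0 < (t n : ℝ) := fun n => by simp only [ht]; positivity
  have htl : Tendsto t atTop (𝓝 0) := by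
    rw [tendsto_subtype_rng]
    exact tendsto_one_div_add_atTop_nhds_zero_nat
  refine ⟨t, ht0, ?_⟩
  set G : I → ℝ := fun s => ∫ z, dF (mix s π ρ) z ∂(ρ : Measure Z) -
      ∫ z, dF (mix s π ρ) z ∂(π : Measure Z) with hG
  have hGc : Continuous G := hd.continuous_integral_sub hosc π ρ
  obtain ⟨K, hK⟩ : ∃ K, ∀ s, ‖G s‖ ≤ K := by
    obtain ⟨K, hK⟩ := isCompact_univ.exists_bound_of_continuousOn hGc.continuousOn
    exact ⟨K, fun s => hK s (mem_univ s)⟩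
  have heq : ∀ n, (F (mix (t n) π ρ) - F π) / t n = ∫ η : I, G (η * t n) := fun n => by
    rw [hd.mix_sub_eq hosc, mul_div_cancel_left₀ _ (ht0 n).ne']
  simp only [heq]
  have h0 : ∫ z, dF π z ∂(ρ : Measure Z) - ∫ z, dF π z ∂(π : Measure Z) = ∫ _ : I, G 0 := by
    rw [integral_const]; simp [hG, mix_zero]
  rw [h0]
  refine tendsto_integral_of_dominated_convergence (fun _ => K)
    (fun n => (hGc.comp (continuous_id.mul continuous_const)).measurable.aestronglyMeasurable)
    (integrable_const _) (fun n => ae_of_all _ fun η => hK _) (ae_of_all _ fun η => ?_)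
  refine (hGc.tendsto 0).comp ?_
  simpa using htl.const_mul η

/-- By convexity every slope from `π` towards `ρ` is at most `F ρ - F π`; the derivative is a limit
of such slopes. -/
theorem integral_sub_le_of_convex (hd : HasLinearDerivative F dF)
    (hosc : ∀ π z z', dF π z - dF π z' ≤ C)
    (hconv : ∀ (t : I) (π π' : ProbabilityMeasure Z),
      F (mix t π π') ≤ (1 - (t : ℝ)) * F π + (t : ℝ) * F π') (π ρ : ProbabilityMeasure Z) :
    ∫ z, dF π z ∂(ρ : Measure Z) - ∫ z, dF π z ∂(π : Measure Z) ≤ F ρ - F π := by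
  obtain ⟨t, ht0, ht⟩ := hd.tendsto_slope hosc π ρ
  refine le_of_tendsto' ht fun n => ?_
  rw [div_le_iff₀ (ht0 n)]
  linarith [hconv (t n) π ρ]

/-- `F` is Lipschitz for the total variation distance. -/
theorem sub_le_of_hasDensity (hd : HasLinearDerivative F dF)
    (hosc : ∀ π z z', dF π z - dF π z' ≤ C) {R : Measure Z} {P Q : ProbabilityMeasure Z}
    {p q : Z → ℝ} (hp : HasDensity (P : Measure Z) R p) (hq : HasDensity (Q : Measure Z) R q) :
    F P - F Q ≤ C * ∫ z, |q z - p z| ∂ R := by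
  obtain ⟨z₀⟩ := P.nonempty
  rw [hd.sub_eq]
  have hi := (hq.integrable.sub hp.integrable).abs
  suffices h : ∀ η : I, ‖∫ z, dF (mix η Q P) z ∂(P : Measure Z) -
      ∫ z, dF (mix η Q P) z ∂(Q : Measure Z)‖ ≤ C * ∫ z, |q z - p z| ∂ R by
    have := norm_integral_le_of_norm_le_const (μ := (volume : Measure I)) (ae_of_all _ h)
    rw [probReal_univ, mul_one] at this
    exact (le_abs_self _).trans this
  intro η
  set m := mix η Q P
  have hI : ∀ P' : ProbabilityMeasure Z,
      Integrable (fun z => dF m z - dF m z₀) (P' : Measure Z) := fun P' =>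
    (hd.integrable hosc m P').sub (integrable_const _)
  rw [hd.integral_sub_eq hosc m Q P z₀, hp.integral_eq, hq.integral_eq,
    ← integral_sub (hp.integrable_iff.1 (hI P)) (hq.integrable_iff.1 (hI Q)),
    ← integral_const_mul]
  refine norm_integral_le_of_norm_le (hi.const_mul C) (ae_of_all _ fun z => ?_)
  have h1 : |dF m z - dF m z₀| ≤ C := abs_sub_le_iff.2 ⟨hosc _ _ _, hosc _ _ _⟩
  rw [← sub_mul, norm_mul, Real.norm_eq_abs, Real.norm_eq_abs, mul_comm, abs_sub_comm (q z)]
  exact mul_le_mul_of_nonneg_right h1 (abs_nonneg _)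

end HasLinearDerivative

end LinearDerivative

/-! ### Existence and uniqueness of the energy minimizer -/

section Existence

/-- A sequence of nonnegative functions that is Cauchy in `L¹` has a nonnegative limit, which is
also an a.e. limit along a subsequence. -/
theorem exists_nonneg_limit_of_cauchy_integral {Z : Type*} [MeasurableSpace Z] {R : Measure Z}
    {p : ℕ → Z → ℝ} (hi : ∀ n, Integrable (p n) R) (h0 : ∀ n z, 0 ≤ p n z)
    (hc : ∀ ε > 0, ∃ N, ∀ m ≥ N, ∀ n ≥ N, ∫ z, |p m z - p n z| ∂ R < ε) :
    ∃ q : Z → ℝ, Measurable q ∧ (∀ z, 0 ≤ q z) ∧ Integrable q R ∧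
      Tendsto (fun n => ∫ z, |p n z - q z| ∂ R) atTop (𝓝 0) ∧
      ∃ ns : ℕ → ℕ, StrictMono ns ∧
        ∀ᵐ z ∂ R, Tendsto (fun k => p (ns k) z) atTop (𝓝 (q z)) := by
  have hcau : CauchySeq fun n => (hi n).toL1 (p n) := by
    refine Metric.cauchySeq_iff.2 fun ε hε => ?_
    obtain ⟨N, hN⟩ := hc ε hε
    refine ⟨N, fun m hm n hn => ?_⟩
    rw [dist_eq_norm, integrable_toL1_sub_norm_eq]
    exact hN m hm n hn
  obtain ⟨h, hh⟩ := cauchySeq_tendsto_of_complete hcau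
  have hm : Measurable h := (Lp.stronglyMeasurable h).measurable
  have hhi : Integrable h R := L1.integrable_coeFn h
  have hlim : Tendsto (fun n => ∫ z, |p n z - h z| ∂ R) atTop (𝓝 0) := by
    have := tendsto_iff_norm_sub_tendsto_zero.1 hh
    refine this.congr fun n => ?_
    rw [← integrable_toL1_sub_norm_eq (hi n) hhi, Integrable.toL1_coeFn]
  have hqi : Integrable (fun z => max (h z) 0) R := hhi.pos_part
  refine ⟨fun z => max (h z) 0, hm.max measurable_const, fun z => le_max_right _ _, hqi, ?_, ?_⟩
  · refine squeeze_zero (fun n => integral_nonneg fun z => abs_nonneg _) (fun n => ?_) hlim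
    refine integral_mono ((hi n).sub hqi).abs ((hi n).sub hhi).abs fun z => ?_
    have h1 := h0 n z
    change |p n z - max (h z) 0| ≤ |p n z - h z|
    grind
  · obtain ⟨ns, hns, hae⟩ := (tendstoInMeasure_of_tendsto_Lp hh).exists_seq_tendsto_ae
    refine ⟨ns, hns, ?_⟩
    filter_upwards [hae, ae_all_iff.2 fun n => (hi n).coeFn_toL1] with z h1 h2
    have h3 : Tendsto (fun k => p (ns k) z) atTop (𝓝 (h z)) := h1.congr fun k => h2 _
    rwa [max_eq_left (ge_of_tendsto' h3 fun k => h0 _ z)]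

/-- A Pinsker type inequality: the midpoint convexity of entropy controls the total variation. -/
theorem integral_abs_sub_le_of_midpoint {Z : Type*} [MeasurableSpace Z]
    {P Q R : ProbabilityMeasure Z} {p q : Z → ℝ} (hp : HasDensity (P : Measure Z) R p)
    (hq : HasDensity (Q : Measure Z) R q) (hP : klDiv (P : Measure Z) (R : Measure Z) ≠ ∞)
    (hQ : klDiv (Q : Measure Z) (R : Measure Z) ≠ ∞) {t : I} (ht : (t : ℝ) = 1 / 2) {l : ℝ}
    (hl : 0 < l) :
    ∫ z, |p z - q z| ∂(R : Measure Z) ≤ l * 2 + 2 / l *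
      (((klDiv (P : Measure Z) (R : Measure Z)).toReal +
        (klDiv (Q : Measure Z) (R : Measure Z)).toReal) / 2 -
        (klDiv (mix t P Q : Measure Z) (R : Measure Z)).toReal) := by
  have hmix := hp.mix hq t
  have ip := hp.klDiv_ne_top_iff.1 hP
  have iq := hq.klDiv_ne_top_iff.1 hQ
  have im := hmix.klDiv_ne_top_iff.1 (klDiv_mix_ne_top_and_le hP hQ t).1
  have i1 : Integrable (fun z => l * (p z + q z)) (R : Measure Z) :=
    (hp.integrable.add hq.integrable).const_mul l
  have i2 : Integrable (fun z => (klFun (p z) + klFun (q z)) / 2) (R : Measure Z) :=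
    (ip.add iq).div_const 2
  have i3 : Integrable (fun z => 2 / l * ((klFun (p z) + klFun (q z)) / 2 -
      klFun ((1 - (t : ℝ)) * p z + t * q z))) (R : Measure Z) := (i2.sub im).const_mul _
  calc ∫ z, |p z - q z| ∂(R : Measure Z)
      ≤ ∫ z, l * (p z + q z) + 2 / l * ((klFun (p z) + klFun (q z)) / 2 -
          klFun ((1 - (t : ℝ)) * p z + t * q z)) ∂(R : Measure Z) := by
        refine integral_mono (hp.integrable.sub hq.integrable).abs (i1.add i3) fun z => ?_
        have := abs_sub_le_midpoint_klFun (hp.nonneg z) (hq.nonneg z) hl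
        rw [← ht] at this
        exact this
    _ = _ := by
        rw [integral_add i1 i3, integral_const_mul, integral_const_mul, integral_sub i2 im,
          integral_div, integral_add ip iq, integral_add hp.integrable hq.integrable,
          hp.integral_eq_one, hq.integral_eq_one, hp.toReal_klDiv, hq.toReal_klDiv,
          hmix.toReal_klDiv]
        norm_num

variable {X Y : Type*} [TopologicalSpace X] [MeasurableSpace X] [TopologicalSpace Y]
  [MeasurableSpace Y] [OpensMeasurableSpace (X × Y)] {μ : ProbabilityMeasure X}
  {ν : ProbabilityMeasure Y} {R : ProbabilityMeasure (X × Y)}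
  {F : ProbabilityMeasure (X × Y) → ℝ} {dF : ProbabilityMeasure (X × Y) → X × Y → ℝ} {C : ℝ}

/-- Direct method: a minimizing sequence is Cauchy in `L¹(R)` by uniform convexity of entropy. -/
theorem exists_mem_argminOn_energy (hd : HasLinearDerivative F dF)
    (hosc : ∀ π z z', dF π z - dF π z' ≤ C)
    (hconv : ∀ (t : I) (π π' : ProbabilityMeasure (X × Y)),
      F (mix t π π') ≤ (1 - (t : ℝ)) * F π + (t : ℝ) * F π') (hF0 : ∀ π, 0 ≤ F π)
    {P₀ : ProbabilityMeasure (X × Y)} (hP₀ : P₀ ∈ couplings μ ν)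
    (hP₀k : klDiv (P₀ : Measure (X × Y)) (R : Measure (X × Y)) ≠ ∞) :
    ∃ π, π ∈ argminOn (energy R F) (couplings μ ν) ∧
      klDiv (π : Measure (X × Y)) (R : Measure (X × Y)) ≠ ∞ := by
  set A : Set (ProbabilityMeasure (X × Y)) :=
    {π | π ∈ couplings μ ν ∧ klDiv (π : Measure (X × Y)) (R : Measure (X × Y)) ≠ ∞} with hA
  set H : ProbabilityMeasure (X × Y) → ℝ :=
    fun π => (klDiv (π : Measure (X × Y)) (R : Measure (X × Y))).toReal with hH
  set V : ProbabilityMeasure (X × Y) → ℝ := fun π => F π + H π with hV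
  have hne : (V '' A).Nonempty := ⟨_, mem_image_of_mem V (show P₀ ∈ A from ⟨hP₀, hP₀k⟩)⟩
  have hbdd : BddBelow (V '' A) := by
    refine ⟨0, ?_⟩
    rintro _ ⟨π, -, rfl⟩
    exact add_nonneg (hF0 π) ENNReal.toReal_nonneg
  set m := sInf (V '' A) with hmdef
  have hmle : ∀ π ∈ A, m ≤ V π := fun π hπ => csInf_le hbdd (mem_image_of_mem V hπ)
  obtain ⟨u, -, hu, humem⟩ := exists_seq_tendsto_sInf hne hbdd
  choose P hPA hPu using humem
  have hVP : Tendsto (fun n => V (P n)) atTop (𝓝 m) := by simpa only [hPu] using hu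
  have hac := fun n => (InformationTheory.klDiv_ne_top_iff.1 (hPA n).2).1
  set p : ℕ → X × Y → ℝ :=
    fun n z => ((P n : Measure (X × Y)).rnDeriv (R : Measure (X × Y)) z).toReal
  have hp : ∀ n, HasDensity (P n : Measure (X × Y)) (R : Measure (X × Y)) (p n) :=
    fun n => hasDensity_rnDeriv (hac n)
  have hcauchy : ∀ ε > 0, ∃ N, ∀ a ≥ N, ∀ b ≥ N,
      ∫ z, |p a z - p b z| ∂(R : Measure (X × Y)) < ε := by
    intro ε hε
    -- With `l = ε / 4` and entropy gap below `ε ^ 2 / 32`, the Pinsker type bound is `ε / 2` plus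
    -- less than `ε / 4`.
    have hl : 0 < ε / 4 := by positivity
    have hev := (tendsto_order.1 hVP).2 (m + ε ^ 2 / 32) (lt_add_of_pos_right m (by positivity))
    obtain ⟨N, hN⟩ := eventually_atTop.1 hev
    refine ⟨N, fun a ha b hb => ?_⟩
    set t : I := ⟨1 / 2, by norm_num, by norm_num⟩ with ht
    obtain ⟨hkm, -⟩ := klDiv_mix_ne_top_and_le (hPA a).2 (hPA b).2 t
    have h1 := hmle _ ⟨mix_mem_couplings (hPA a).1 (hPA b).1 t, hkm⟩
    have h2 := hconv t (P a) (P b)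
    have h3 := integral_abs_sub_le_of_midpoint (hp a) (hp b) (hPA a).2 (hPA b).2 (t := t) rfl hl
    -- The midpoint has energy at least `m`, both ends have energy below `m + ε ^ 2 / 32`, and
    -- convexity of `F` discards its contribution.
    have h4 : (H (P a) + H (P b)) / 2 - H (mix t (P a) (P b)) < ε ^ 2 / 32 := by
      have e1 := hN a ha
      have e2 := hN b hb
      simp only [hV] at h1 e1 e2
      simp only [ht] at h1 h2 ⊢
      linarith
    have h5 : 2 / (ε / 4) * ((H (P a) + H (P b)) / 2 - H (mix t (P a) (P b))) <
        2 / (ε / 4) * (ε ^ 2 / 32) := mul_lt_mul_of_pos_left h4 (by positivity)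
    have h6 : 2 / (ε / 4) * (ε ^ 2 / 32) = ε / 4 := by field_simp; norm_num
    simp only [hH] at h5
    linarith
  obtain ⟨q, hqm, hq0, hqi, hqlim, ns, hns, hae⟩ :=
    exists_nonneg_limit_of_cauchy_integral (fun n => (hp n).integrable)
      (fun n => (hp n).nonneg) hcauchy
  have hset : ∀ B : Set (X × Y), Tendsto (fun n => ∫ z in B, p n z ∂(R : Measure (X × Y))) atTop
      (𝓝 (∫ z in B, q z ∂(R : Measure (X × Y)))) := by
    intro B
    rw [tendsto_iff_norm_sub_tendsto_zero]
    refine squeeze_zero (fun n => norm_nonneg _) (fun n => ?_) hqlim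
    rw [← integral_sub (hp n).integrable.integrableOn hqi.integrableOn]
    refine (norm_integral_le_integral_norm _).trans ?_
    exact setIntegral_le_integral ((hp n).integrable.sub hqi).abs
      (ae_of_all _ fun z => abs_nonneg _)
  have hq1 : ∫ z, q z ∂(R : Measure (X × Y)) = 1 := by
    have h := hset univ
    simp only [setIntegral_univ, fun n => (hp n).integral_eq_one] at h
    exact (tendsto_nhds_unique h tendsto_const_nhds)
  obtain ⟨π, hπ⟩ := exists_probabilityMeasure_hasDensity hqm hq0 hqi hq1
  have hπc : π ∈ couplings μ ν := by
    have hB : ∀ B : Set (X × Y), MeasurableSet B →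
        (∀ n, (P n : Measure (X × Y)).real B = (P 0 : Measure (X × Y)).real B) →
        (π : Measure (X × Y)).real B = (P 0 : Measure (X × Y)).real B := by
      intro B hB hconst
      rw [hπ.measureReal_eq hB]
      refine tendsto_nhds_unique ((hset B).congr fun n => ?_) tendsto_const_nhds
      rw [← (hp n).measureReal_eq hB, hconst n]
    refine mem_couplings_of_measureReal_eq (hPA 0).1
      (fun B hBm => hB _ (measurable_fst hBm) fun n => ?_)
      (fun B hBm => hB _ (measurable_snd hBm) fun n => ?_)
    · rw [← map_measureReal_apply measurable_fst hBm, ← map_measureReal_apply measurable_fst hBm,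
        (hPA n).1.1, (hPA 0).1.1]
    · rw [← map_measureReal_apply measurable_snd hBm, ← map_measureReal_apply measurable_snd hBm,
        (hPA n).1.2, (hPA 0).1.2]
  -- An upper bound of `H (P n)` in which `F (P n)` is replaced by `F π`, at the cost of the total
  -- variation term. Fatou then gives `H π ≤ m - F π`.
  set δ : ℕ → ℝ := fun n => V (P n) + C * ∫ z, |p n z - q z| ∂(R : Measure (X × Y)) - F π
  have hδ : Tendsto δ atTop (𝓝 (m - F π)) := by
    simpa using (hVP.add (hqlim.const_mul C)).sub_const (F π)
  have hHδ : ∀ n, H (P n) ≤ δ n := fun n => by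
    have := hd.sub_le_of_hasDensity hosc hπ (hp n)
    simp only [δ, hV]
    linarith
  have hkl : klDiv (π : Measure (X × Y)) (R : Measure (X × Y)) ≤ ENNReal.ofReal (m - F π) := by
    rw [hπ.klDiv_eq]
    calc ∫⁻ z, ENNReal.ofReal (klFun (q z)) ∂(R : Measure (X × Y))
        = ∫⁻ z, liminf (fun k => ENNReal.ofReal (klFun (p (ns k) z))) atTop
            ∂(R : Measure (X × Y)) := by
          refine lintegral_congr_ae ?_
          filter_upwards [hae] with z hz
          exact ((ENNReal.continuous_ofReal.comp continuous_klFun).tendsto _ |>.comp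
            hz).liminf_eq.symm
      _ ≤ liminf (fun k => ∫⁻ z, ENNReal.ofReal (klFun (p (ns k) z)) ∂(R : Measure (X × Y)))
            atTop := lintegral_liminf_le fun k => (hp (ns k)).measurable_klFun_comp.ennreal_ofReal
      _ ≤ liminf (fun k => ENNReal.ofReal (δ (ns k))) atTop := by
          refine liminf_le_liminf (Eventually.of_forall fun k => ?_)
          rw [← (hp (ns k)).klDiv_eq, ← ENNReal.ofReal_toReal (hPA (ns k)).2]
          exact ENNReal.ofReal_le_ofReal (hHδ _)
      _ = ENNReal.ofReal (m - F π) :=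
          ((ENNReal.continuous_ofReal.tendsto _).comp (hδ.comp hns.tendsto_atTop)).liminf_eq
  have hk : klDiv (π : Measure (X × Y)) (R : Measure (X × Y)) ≠ ∞ :=
    ne_top_of_le_ne_top ENNReal.ofReal_ne_top hkl
  have hnn : 0 ≤ m - F π :=
    ge_of_tendsto' hδ fun n => ENNReal.toReal_nonneg.trans (hHδ n)
  have hVπ : V π ≤ m := by
    have : H π ≤ m - F π := ENNReal.toReal_le_of_le_ofReal hnn hkl
    simp only [hV]
    linarith
  refine ⟨π, ⟨hπc, fun ρ hρ => ?_⟩, hk⟩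
  unfold energy
  exact (coe_add_coe_ennreal_le_iff hk).2 fun hρk => hVπ.trans (hmle ρ ⟨hρ, hρk⟩)

/-- A minimizer of the energy is a minimizer of its own linearization. -/
theorem mem_bestResponse_of_mem_argminOn_energy (hd : HasLinearDerivative F dF)
    (hosc : ∀ π z z', dF π z - dF π z' ≤ C) {π : ProbabilityMeasure (X × Y)}
    (hπ : π ∈ argminOn (energy R F) (couplings μ ν))
    (hk : klDiv (π : Measure (X × Y)) (R : Measure (X × Y)) ≠ ∞) :
    π ∈ bestResponse μ ν R dF π := by
  refine ⟨hπ.1, fun ρ hρ => ?_⟩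
  unfold innerObjective
  refine (coe_add_coe_ennreal_le_iff hk).2 fun hρk => ?_
  obtain ⟨t, ht0, ht⟩ := hd.tendsto_slope hosc π ρ
  suffices h : (klDiv (π : Measure (X × Y)) (R : Measure (X × Y))).toReal -
      (klDiv (ρ : Measure (X × Y)) (R : Measure (X × Y))).toReal ≤
      ∫ z, dF π z ∂(ρ : Measure (X × Y)) - ∫ z, dF π z ∂(π : Measure (X × Y)) by linarith
  -- Minimality bounds the increase of `F` below by the decrease of entropy, which by convexity is
  -- at least `t n` times `H π - H ρ`.
  refine ge_of_tendsto' ht fun n => ?_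
  obtain ⟨hkm, hle⟩ := klDiv_mix_ne_top_and_le hk hρk (t n)
  have h := hπ.2 _ (mix_mem_couplings hπ.1 hρ (t n))
  unfold energy at h
  have h' := (coe_add_coe_ennreal_le_iff hk).1 h hkm
  rw [le_div_iff₀ (ht0 n)]
  linarith

/-- If the linearization at `π` has `π` as its unique minimizer, then the convex energy has `π` as
its unique minimizer. -/
theorem argminOn_energy_eq_singleton (hd : HasLinearDerivative F dF)
    (hosc : ∀ π z z', dF π z - dF π z' ≤ C)
    (hconv : ∀ (t : I) (π π' : ProbabilityMeasure (X × Y)),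
      F (mix t π π') ≤ (1 - (t : ℝ)) * F π + (t : ℝ) * F π') {π : ProbabilityMeasure (X × Y)}
    (hπ : π ∈ argminOn (energy R F) (couplings μ ν))
    (hk : klDiv (π : Measure (X × Y)) (R : Measure (X × Y)) ≠ ∞)
    (hbr : bestResponse μ ν R dF π = {π}) :
    argminOn (energy R F) (couplings μ ν) = {π} := by
  refine Subset.antisymm (fun ρ hρ => ?_) (singleton_subset_iff.2 hπ)
  rw [← hbr]
  have h := hρ.2 π hπ.1
  unfold energy at h
  have hρk := ne_top_of_coe_add_coe_ennreal_le hk h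
  have h1 := (coe_add_coe_ennreal_le_iff hρk).1 h hk
  have h2 := hd.integral_sub_le_of_convex hosc hconv π ρ
  have hπ' : π ∈ bestResponse μ ν R dF π := by rw [hbr]; rfl
  refine ⟨hρ.1, fun τ hτ => le_trans ?_ (hπ'.2 τ hτ)⟩
  unfold innerObjective
  exact (coe_add_coe_ennreal_le_iff hρk).2 fun _ => by linarith

end Existence

/-! ### Gibbs form of the minimizer -/

section Gibbs

variable {X Y : Type*} [MeasurableSpace X] [MeasurableSpace Y] {R : ProbabilityMeasure (X × Y)}
  {dF : ProbabilityMeasure (X × Y) → X × Y → ℝ} {π : ProbabilityMeasure (X × Y)} {C : ℝ}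

/-- The Gibbs form of a solution of the first-order system. -/
theorem eq_tilted_tiltedReference_of_firstOrder (hm : Measurable (dF π))
    (hb : ∀ z, |dF π z| ≤ C) {f : X → ℝ} {g : Y → ℝ} {c : ℝ}
    (hfo : FirstOrder R dF π f g c) :
    (π : Measure (X × Y)) = (tiltedReference R dF π).tilted (fun z => -(f z.1 + g z.2)) := by
  have hp := hasDensity_rnDeriv hfo.1
  set p : X × Y → ℝ := fun z => ((π : Measure (X × Y)).rnDeriv (R : Measure (X × Y)) z).toReal
  have hexp : Integrable (fun z => Real.exp (-dF π z)) (R : Measure (X × Y)) := by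
    refine Integrable.of_bound hm.neg.exp.aestronglyMeasurable (Real.exp C)
      (ae_of_all _ fun z => ?_)
    rw [Real.norm_of_nonneg (Real.exp_pos _).le]
    exact Real.exp_le_exp.2 (by linarith [(abs_le.1 (hb z)).1])
  -- The total exponential weight is `e^{-c} p`; as `p` has integral one, the normalizing constant
  -- is `e^{-c}`.
  have hpe : ∀ᵐ z ∂(R : Measure (X × Y)),
      Real.exp (-dF π z + -(f z.1 + g z.2)) = Real.exp (-c) * p z := by
    filter_upwards [hfo.2, Measure.rnDeriv_lt_top (π : Measure (X × Y)) (R : Measure (X × Y))]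
      with z hz hlt
    have h1 : 0 < p z := ENNReal.toReal_pos hz.1.ne' hlt.ne
    have h2 : dF π z + Real.log (p z) + f z.1 + g z.2 = c := hz.2
    rw [show p z = Real.exp (Real.log (p z)) from (Real.exp_log h1).symm, ← Real.exp_add]
    congr 1
    linarith
  rw [tiltedReference, tilted_tilted hexp, Measure.tilted]
  simp only [Pi.add_apply]
  rw [integral_congr_ae hpe, integral_const_mul, hp.integral_eq_one, mul_one]
  conv_lhs => rw [hp.eq]
  refine withDensity_congr_ae ?_
  filter_upwards [hpe] with z hz
  rw [hz, mul_div_cancel_left₀ _ (Real.exp_pos _).ne']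

end Gibbs

end EntropicOT

/-! ### The main theorem -/

open EntropicOT in
theorem mainTheorem4 {X Y : Type*}
    [MetricSpace X] [CompleteSpace X] [SecondCountableTopology X] [BoundedSpace X]
    [MeasurableSpace X] [BorelSpace X]
    [MetricSpace Y] [CompleteSpace Y] [SecondCountableTopology Y] [BoundedSpace Y]
    [MeasurableSpace Y] [BorelSpace Y]
    (μ : ProbabilityMeasure X) (ν : ProbabilityMeasure Y) (R : ProbabilityMeasure (X × Y))
    (hR : (R : Measure (X × Y)) ≪ (μ : Measure X).prod (ν : Measure Y))
    (F : ProbabilityMeasure (X × Y) → ℝ) (dF : ProbabilityMeasure (X × Y) → X × Y → ℝ)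
    (hF : CostAssumption μ ν F dF)
    (hP₀ : ∃ P₀ ∈ couplings μ ν, HasBoundedDensity P₀ R) :
    (∃ πs : ProbabilityMeasure (X × Y),
      argminOn (energy R F) (couplings μ ν) = {πs} ∧
      bestResponse μ ν R dF πs = {πs} ∧
      ∃ (f : X → ℝ) (g : Y → ℝ) (c : ℝ), Measurable f ∧ Measurable g ∧
        FirstOrder R dF πs f g c ∧
        (πs : Measure (X × Y)) =
          (tiltedReference R dF πs).tilted (fun z => -(f z.1 + g z.2))) ∧
    ∀ π ∈ couplings μ ν,
      (bestResponse μ ν R dF π = {π} ↔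
        ∃ (f : X → ℝ) (g : Y → ℝ) (c : ℝ), Measurable f ∧ Measurable g ∧
          FirstOrder R dF π f g c) := by
  obtain ⟨P₀, hP₀, hP₀b⟩ := hP₀
  obtain ⟨C, -, hosc⟩ := hF.bounded_osc
  have hd := hF.hasLinearDerivative
  have hP₀k := klDiv_ne_top_of_hasBoundedDensity hP₀b
  have : Nonempty (X × Y) := P₀.nonempty
  have key : ∀ π, π ∈ bestResponse μ ν R dF π → ∃ (f : X → ℝ) (g : Y → ℝ) (c : ℝ),
      Measurable f ∧ Measurable g ∧ FirstOrder R dF π f g c := by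
    intro π hπ
    obtain ⟨K, hK⟩ := exists_abs_le_of_osc (hosc π)
    exact exists_firstOrder_of_mem_bestResponse hR (hd.measurable π) hK hπ hP₀ hP₀b
  have key' : ∀ π ∈ couplings μ ν, ∀ (f : X → ℝ) (g : Y → ℝ) (c : ℝ), Measurable f → Measurable g →
      FirstOrder R dF π f g c → bestResponse μ ν R dF π = {π} := by
    intro π hπ f g c hf hg hfo
    obtain ⟨K, hK⟩ := exists_abs_le_of_osc (hosc π)
    exact bestResponse_eq_singleton_of_firstOrder (hd.measurable π) hK hπ hf hg hfo hP₀ hP₀k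
  constructor
  · obtain ⟨πs, hπs, hk⟩ := exists_mem_argminOn_energy (R := R) hd hosc hF.convex hF.nonneg hP₀ hP₀k
    obtain ⟨f, g, c, hf, hg, hfo⟩ :=
      key πs (mem_bestResponse_of_mem_argminOn_energy hd hosc hπs hk)
    have hbr := key' πs hπs.1 f g c hf hg hfo
    obtain ⟨K, hK⟩ := exists_abs_le_of_osc (hosc πs)
    exact ⟨πs, argminOn_energy_eq_singleton hd hosc hF.convex hπs hk hbr, hbr, f, g, c, hf, hg, hfo,
      eq_tilted_tiltedReference_of_firstOrder (hd.measurable πs) hK hfo⟩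
  · refine fun π hπ => ⟨fun h => key π (by rw [h]; rfl), ?_⟩
    rintro ⟨f, g, c, hf, hg, hfo⟩
    exact key' π hπ f g c hf hg hfo
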